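/- A constrained MDP (CMDP) is a tuple $\langle \mathcal S,\mathcal A,P,r,c,b,\rho,\gamma\rangle$ with finite $\mathcal S$, $\mathcal A$, transition probabilities $P(\cdot\mid s,a)$, rewards $r:\mathcal S\times\mathcal A\to[0,1]$, constraint rewards $c:\mathcal S\times\mathcal A\to[0,1]$, threshold $b\in\mathbb R$, initial distribution $\rho$ and discount factor $\gamma\in[0,1)$. For a stationary stochastic policy $\pi$ let $V_f^\pi(\rho)=\mathbb E\big[\sum_{t\ge0}\gamma^t f(s_t,a_t)\big]$, where $s_0\sim\rho$, $a_t\sim\pi(\cdot\mid s_t)$, $s_{t+1}\sim P(\cdot\mid s_t,a_t)$. The Slater constant of the CMDP is $\zeta=\max_\pi V_c^\pi(\rho)-b$, and $V_r^*(\rho)$ is the maximum of $V_r^\pi(\rho)$ over the policies with $V_c^\pi(\rho)\ge b$. The data $r,c,b,\rho,\gamma$ are known to the learner; $P$ is unknown. An algorithm is randomized and adaptive: at each step it either asks a generative model for an independent sample from $P(\cdot\mid s,a)$ for a pair $(s,a)$ of its choice, or stops and outputs a (possibly random) policy $\hat\pi$. For given known data and $\zeta$ it is $(\epsilon,\delta)$-sound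 if for every $P$ for which the Slater constant is $\zeta$ it holds with probability at least $1-\delta$ that it stops and outputs a $\hat\pi$ with $V_r^*(\rho)-V_r^{\hat\pi}(\rho)\le\epsilon$ and $V_c^{\hat\pi}(\rho)\ge b$. **Theorem (lower bound under strict feasibility).** There are absolute constants $C,\kappa>0$ and $\delta_0\in(0,1)$, numbers $\gamma_0=\gamma_0(S)$, depending only on the number of states $S$, with $$1-\frac1{\log S}<\gamma_0(S)\le 1-\frac{\kappa}{\log S}\qquad(S\ge2),$$ and numbers $\epsilon_0=\epsilon_0(\gamma,\zeta)$, depending only on $\gamma$ and $\zeta$, with $$\kappa\,B(\gamma,\zeta)\le\epsilon_0(\gamma,\zeta)\le B(\gamma,\zeta):=\frac1{1-\gamma}\min\Big\{1,\frac{\gamma}{(1-\gamma)\zeta}\Big\}\qquad\big(0<\gamma<1,\ 0<\zeta\le\tfrac1{1-\gamma}\big),$$ such that the following holds for all integers $S,A\ge2$, all $\gamma\in(\gamma_0(S),1)$, $\zeta\in(0,\frac1{1-\gamma}]$, $\epsilon\in(0,\epsilon_0(\gamma,\zeta))$ and $\delta\in(0,\delta_0)$. There are known data $r,c,b,\rho$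 on $S$ states and $A$ actions, with discount factor $\gamma$, such that for every algorithm that is $(\epsilon,\delta)$-sound for these data and $\zeta$ there are transition probabilities $P$ for which the Slater constant is $\zeta$ and the expected number of samples that the algorithm takes from the generative model is at least $$C\cdot\frac{S A\,\ln\!\big(1/(4\delta)\big)}{\epsilon^2\zeta^2(1-\gamma)^5}.$$ -/

import Mathlib

open scoped ENNReal

noncomputable section

namespace LowerBound

/-- Stationary stochastic policies `π : S → Δ_A`. -/
abbrev Policy (S A : Type) [Fintype A] : Type := S → stdSimplex ℝ A

/-- The part of a constrained MDP that is known to the learner: the rewards `r`, the constraint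
rewards `c`, the threshold `b`, the initial distribution `ρ` and the discount factor `γ`. -/
structure CMDPSpec (S A : Type) where
  r : S → A → ℝ
  c : S → A → ℝ
  b : ℝ
  ρ : PMF S
  γ : ℝ
  r_mem : ∀ s a, r s a ∈ Set.Icc (0 : ℝ) 1
  c_mem : ∀ s a, c s a ∈ Set.Icc (0 : ℝ) 1
  γ_mem : γ ∈ Set.Ico (0 : ℝ) 1

/-- A constrained MDP `⟨S, A, P, r, c, b, ρ, γ⟩`. -/
structure CMDP (S A : Type) extends CMDPSpec S A where
  P : S → A → PMF S

namespace CMDP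

variable {S A : Type} [Fintype S] [Fintype A]

/-- The law of the state `s_t` when `s_0 ∼ ρ`, `a_t ∼ π(· | s_t)`, `s_{t+1} ∼ P(· | s_t, a_t)`. -/
def stateDist (M : CMDP S A) (π : Policy S A) : ℕ → S → ℝ
  | 0, s => (M.ρ s).toReal
  | t + 1, s' => ∑ s, ∑ a, stateDist M π t s * π s a * (M.P s a s').toReal

/-- The expected discounted return `E[∑_t γ^t f(s_t, a_t)]` of the policy `π` for the per-step
reward `f`. -/
def value (M : CMDP S A) (f : S → A → ℝ) (π : Policy S A) : ℝ :=
  ∑' t : ℕ, M.γ ^ t * ∑ s, ∑ a, stateDist M π t s * π s a * f s a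

/-- The policy `π` satisfies the constraint `V_c^π(ρ) ≥ b`. -/
def Feasible (M : CMDP S A) (π : Policy S A) : Prop :=
  M.b ≤ M.value M.c π

/-- `ζ` is the Slater constant `max_π V_c^π(ρ) - b`. -/
def IsSlaterConstant (M : CMDP S A) (ζ : ℝ) : Prop :=
  IsGreatest (Set.range fun π : Policy S A => M.value M.c π - M.b) ζ

/-- The policies that achieve the strict feasibility objective: they satisfy the constraint, and
their reward value is within `ε` of that of every policy that satisfies the constraint. -/
def strictlyGood (M : CMDP S A) (ε : ℝ) : Set (Policy S A) :=
  {π | (∀ π' : Policy S A, M.Feasible π' → M.value M.r π' - M.value M.r π ≤ ε) ∧ M.Feasible π}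

end CMDP

/-- A (randomized, adaptive) algorithm with access to a generative model. Given the list of the
samples `(s, a, s')` seen so far (the most recent one first), it draws its next move at random:
`some (s, a)` asks the generative model for a sample from `P(· | s, a)`, and `none` stops. When it
stops, it outputs a policy, possibly at random. -/
structure GenAlgorithm (S A : Type) [Fintype A] where
  move : List (S × A × S) → PMF (Option (S × A))
  output : List (S × A × S) → MeasureTheory.Measure (Policy S A)
  output_prob : ∀ h, MeasureTheory.IsProbabilityMeasure (output h)

namespace GenAlgorithm

variable {S A : Type} [Fintype S] [Fintype A]

/-- The probability that the first `h.length` samples of the algorithm are those listed in `h`,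
when the transition probabilities are `P`. -/
def reachProb (K : GenAlgorithm S A) (P : S → A → PMF S) : List (S × A × S) → ℝ≥0∞
  | [] => 1
  | (s, a, s') :: h => reachProb K P h * K.move h (some (s, a)) * P s a s'

/-- The probability that the algorithm stops and outputs a policy in `G`. -/
def outputProb (K : GenAlgorithm S A) (P : S → A → PMF S) (G : Set (Policy S A)) : ℝ≥0∞ :=
  ∑' h : List (S × A × S), K.reachProb P h * K.move h none * K.output h G

/-- The expected number of samples that the algorithm takes from the generative model: the sum over
all histories of the probability that the history occurs and a further sample is requested after it
(it is infinite if that sum diverges, in particular if the algorithm runs forever with positive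
probability). -/
def expectedSamples (K : GenAlgorithm S A) (P : S → A → PMF S) : ℝ≥0∞ :=
  ∑' h : List (S × A × S), K.reachProb P h * ∑ q : S × A, K.move h (some q)

/-- `(ε, δ)`-soundness on the CMDPs with known part `D` and Slater constant `ζ`: on each of them,
with probability at least `1 - δ`, the algorithm outputs a policy that satisfies the constraint and
is `ε`-optimal. -/
def IsSound (K : GenAlgorithm S A) (D : CMDPSpec S A) (ζ ε δ : ℝ) : Prop :=
  ∀ P : S → A → PMF S, (CMDP.mk D P).IsSlaterConstant ζ →
    ENNReal.ofReal (1 - δ) ≤ K.outputProb P ((CMDP.mk D P).strictlyGood ε)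

end GenAlgorithm

end LowerBound

end

noncomputable section

namespace LowerBound

/-! The hard instances put a binary tree with about `S` leaves inside the state space. Every leaf is
left for an absorbing, rewardless sink at discounted rate `2u`, where `u = 1 - γ`, so a unit reward
there is worth `1 / (2u)`. In the base instance all actions at all leaves have the same staying
probability. In the other instances one pair of a leaf and an action other than `left` is boosted:
its rate is `2u(1 - η)`, which multiplies the value of always playing it by `1 / (1 - η)`. The tree
has depth at most logarithmic in `S`, so for `γ` close to `1` on the scale `1 / log S` reaching a
leaf costs at most a factor `2`.

When `ζu` is small, `left` earns constraint reward `1` and no reward, and every other action earns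
reward `1` and constraint reward `1 - χ`, with `χ` of order `uζ`. The threshold lets a policy put
about half of its mass on actions other than `left`. Boosting a pair creates constraint slack of
order `η / u`, and slack is exchanged for reward at rate `1 / χ`. Hence `η` of order `εζu²` already
changes the optimal reward by more than `ε`: a policy feasible in the base instance is too poor in
the boosted one (`target_feasible`, `target_reward_gap`). The Slater constant stays `ζ`, because the
all-`left` policy remains the best one for the constraint (`boost_le`). When `ζu` is bounded below,
`χ` could exceed `1`; then the constraint is made vacuous and an ordinary reward gap suffices
(`not_good_of_reward_gap`).

A sound algorithm therefore has to tell the base instance from each boosted one, and only samples of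
the boosted pair help. The change of measure `log_le_mul_pairSamples` shows that it takes at least
`log (1 / (4δ)) / k` expected samples of that pair under the base instance, where `k`, of order
`uη²`, bounds the divergence per sample. Summing over the pairs, of which there are at least `SA /
8`, gives the bound (`le_expectedSamples`), all for the same base `P`. -/

theorem sum_pmf_toReal {S : Type} [Fintype S] (p : PMF S) : ∑ s, (p s).toReal = 1 := by
  rw [← ENNReal.toReal_sum (fun s _ => p.apply_ne_top s), ← tsum_fintype (L := .unconditional _),
    p.tsum_coe, ENNReal.toReal_one]

theorem continuous_policy_apply {S A : Type} [Fintype A] (s : S) (a : A) :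
    Continuous fun π : Policy S A => π s a :=
  (continuous_apply a).comp (continuous_subtype_val.comp (continuous_apply s))

/-! ### Occupancy measures and continuity of the values -/

namespace CMDP

variable {S A : Type} [Fintype S] [Fintype A] (M : CMDP S A) (π : Policy S A)

theorem stateDist_nonneg (t : ℕ) (s : S) : 0 ≤ M.stateDist π t s := by
  induction t generalizing s with
  | zero => exact ENNReal.toReal_nonneg
  | succ t ih =>
    exact Finset.sum_nonneg fun s _ => Finset.sum_nonneg fun a _ =>
      mul_nonneg (mul_nonneg (ih s) ((π s).2.1 a)) ENNReal.toReal_nonneg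

theorem sum_stateDist (t : ℕ) : ∑ s, M.stateDist π t s = 1 := by
  induction t with
  | zero => exact sum_pmf_toReal M.ρ
  | succ t ih =>
    simp only [stateDist]
    rw [Finset.sum_comm]
    calc ∑ s, ∑ s', ∑ a, M.stateDist π t s * π s a * (M.P s a s').toReal
        = ∑ s, M.stateDist π t s := by
          refine Finset.sum_congr rfl fun s _ => ?_
          rw [Finset.sum_comm]
          simp only [← Finset.mul_sum, sum_pmf_toReal, mul_one]
          exact (congrArg _ (π s).2.2).trans (mul_one _)
      _ = 1 := ih

theorem stateDist_le_one (t : ℕ) (s : S) : M.stateDist π t s ≤ 1 := by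
  rw [← M.sum_stateDist π t]
  exact Finset.single_le_sum (fun s _ => M.stateDist_nonneg π t s) (Finset.mem_univ s)

/-- The discounted occupancy measure of the states. -/
def occupancy (s : S) : ℝ := ∑' t : ℕ, M.γ ^ t * M.stateDist π t s

theorem summable_occupancy (s : S) : Summable fun t : ℕ => M.γ ^ t * M.stateDist π t s :=
  (summable_geometric_of_lt_one M.γ_mem.1 M.γ_mem.2).of_nonneg_of_le
    (fun t => mul_nonneg (pow_nonneg M.γ_mem.1 t) (M.stateDist_nonneg π t s))
    (fun t => mul_le_of_le_one_right (pow_nonneg M.γ_mem.1 t) (M.stateDist_le_one π t s))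

theorem hasSum_occupancy (f : S → A → ℝ) :
    HasSum (fun t : ℕ => M.γ ^ t * ∑ s, ∑ a, M.stateDist π t s * π s a * f s a)
      (∑ s, ∑ a, M.occupancy π s * π s a * f s a) := by
  simp only [Finset.mul_sum]
  refine hasSum_sum fun s _ => hasSum_sum fun a _ => ?_
  simp only [mul_assoc (M.occupancy π s), ← mul_assoc (M.γ ^ _), mul_assoc (M.γ ^ _ * _)]
  exact (M.summable_occupancy π s).hasSum.mul_right _

theorem value_eq_sum_occupancy (f : S → A → ℝ) :
    M.value f π = ∑ s, ∑ a, M.occupancy π s * π s a * f s a :=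
  (M.hasSum_occupancy π f).tsum_eq

/-- Flow balance: split off the term `t = 0` and apply the one-step recursion to the rest of the
series. -/
theorem occupancy_eq (s' : S) :
    M.occupancy π s' = (M.ρ s').toReal +
      M.γ * ∑ s, ∑ a, M.occupancy π s * π s a * (M.P s a s').toReal := by
  rw [occupancy, (M.summable_occupancy π s').tsum_eq_zero_add, pow_zero, one_mul]
  congr 1
  rw [← ((M.hasSum_occupancy π fun s a => (M.P s a s').toReal).mul_left M.γ).tsum_eq]
  exact tsum_congr fun t => by rw [pow_succ', mul_assoc]; rfl

theorem continuous_stateDist (t : ℕ) (s : S) :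
    Continuous fun π : Policy S A => M.stateDist π t s := by
  induction t generalizing s with
  | zero => exact continuous_const
  | succ t ih =>
    exact continuous_finsetSum _ fun s _ => continuous_finsetSum _ fun a _ =>
      ((ih s).mul (continuous_policy_apply s a)).mul continuous_const

theorem continuous_value (f : S → A → ℝ) : Continuous fun π : Policy S A => M.value f π := by
  have h : (fun π : Policy S A => M.value f π) =
      fun π => ∑ s, ∑ a, M.occupancy π s * π s a * f s a :=
    funext fun π => M.value_eq_sum_occupancy π f
  rw [h]
  refine continuous_finsetSum _ fun s _ => continuous_finsetSum _ fun a _ =>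
    (Continuous.mul ?_ (continuous_policy_apply s a)).mul continuous_const
  refine continuous_tsum (fun t => continuous_const.mul (M.continuous_stateDist t s))
    (summable_geometric_of_lt_one M.γ_mem.1 M.γ_mem.2) fun t π => ?_
  rw [Real.norm_of_nonneg (mul_nonneg (pow_nonneg M.γ_mem.1 t) (M.stateDist_nonneg π t s))]
  exact mul_le_of_le_one_right (pow_nonneg M.γ_mem.1 t) (M.stateDist_le_one π t s)

/-- The set is closed, being an intersection of non-strict inequalities between continuous functions
of the policy. It allows output probabilities to be complemented. -/
theorem measurableSet_strictlyGood (ε : ℝ) : MeasurableSet (M.strictlyGood ε) := by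
  have h : M.strictlyGood ε = (⋂ π', ⋂ _ : M.Feasible π',
      {π : Policy S A | M.value M.r π' - M.value M.r π ≤ ε}) ∩ {π | M.b ≤ M.value M.c π} := by
    ext π
    simp [strictlyGood, Feasible]
  rw [h]
  exact ((isClosed_iInter fun π' => isClosed_iInter fun _ =>
      isClosed_le (continuous_const.sub (M.continuous_value M.r)) continuous_const).inter
    (isClosed_le continuous_const (M.continuous_value M.c))).measurableSet

end CMDP

/-! ### Enumerating histories by length -/

/-- The lists of length `n` over a finite type. -/
def listsOfLength (α : Type) [Fintype α] : ℕ → Finset (List α)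
  | 0 => {[]}
  | n + 1 => (Finset.univ ×ˢ listsOfLength α n).map
      ⟨fun p => p.1 :: p.2, fun _ _ h => Prod.ext (List.cons.inj h).1 (List.cons.inj h).2⟩

section ListsOfLength

variable {α : Type} [Fintype α]

theorem sum_listsOfLength_succ (n : ℕ) (F : List α → ℝ) :
    ∑ h ∈ listsOfLength α (n + 1), F h = ∑ h ∈ listsOfLength α n, ∑ a, F (a :: h) := by
  rw [listsOfLength, Finset.sum_map, Finset.sum_product_right]
  rfl

theorem mem_listsOfLength {n : ℕ} {h : List α} : h ∈ listsOfLength α n ↔ h.length = n := by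
  induction n generalizing h with
  | zero => simp [listsOfLength]
  | succ n ih =>
    cases h with
    | nil => simp [listsOfLength]
    | cons x h =>
      rw [listsOfLength, Finset.mem_map, List.length_cons, add_left_inj, ← ih]
      constructor
      · rintro ⟨p, hp, hph⟩
        exact (List.cons.inj hph).2 ▸ (Finset.mem_product.1 hp).2
      · exact fun hh => ⟨(x, h), Finset.mem_product.2 ⟨Finset.mem_univ x, hh⟩, rfl⟩

open Classical in
/-- The lists of length less than `n` over a finite type. -/
def listsShorter (α : Type) [Fintype α] (n : ℕ) : Finset (List α) :=
  (Finset.range n).biUnion (listsOfLength α)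

theorem sum_listsShorter (n : ℕ) (F : List α → ℝ) :
    ∑ h ∈ listsShorter α n, F h = ∑ k ∈ Finset.range n, ∑ h ∈ listsOfLength α k, F h := by
  classical
  refine Finset.sum_biUnion fun i _ j _ hij => ?_
  rw [Function.onFun, Finset.disjoint_left]
  intro h hi hj
  exact hij (mem_listsOfLength.1 hi ▸ mem_listsOfLength.1 hj)

theorem exists_subset_listsShorter (s : Finset (List α)) : ∃ n, s ⊆ listsShorter α n := by
  classical
  refine ⟨s.sup List.length + 1, fun h hs => ?_⟩
  simp only [listsShorter, Finset.mem_biUnion, Finset.mem_range, mem_listsOfLength]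
  exact ⟨_, Nat.lt_succ_of_le (Finset.le_sup (f := List.length) hs), rfl⟩

end ListsOfLength

/-! ### Change of measure for adaptive algorithms -/

namespace GenAlgorithm

variable {S A : Type} [Fintype A] (K : GenAlgorithm S A) (P : S → A → PMF S)

theorem reachProb_ne_top (h : List (S × A × S)) : K.reachProb P h ≠ ∞ := by
  induction h with
  | nil => simp [reachProb]
  | cons x h ih =>
    exact ENNReal.mul_ne_top (ENNReal.mul_ne_top ih (PMF.apply_ne_top _ _)) (PMF.apply_ne_top _ _)

/-- The real value of `reachProb`. -/
def reach (h : List (S × A × S)) : ℝ := (K.reachProb P h).toReal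

theorem reach_nonneg (h : List (S × A × S)) : 0 ≤ K.reach P h := ENNReal.toReal_nonneg

theorem reach_nil : K.reach P [] = 1 := by simp [reach, reachProb]

theorem reach_cons (x : S × A × S) (h : List (S × A × S)) :
    K.reach P (x :: h) =
      K.reach P h * (K.move h (some (x.1, x.2.1))).toReal * (P x.1 x.2.1 x.2.2).toReal := by
  simp [reach, reachProb]

theorem outputProb_mono {G G' : Set (Policy S A)} (h : G ⊆ G') :
    K.outputProb P G ≤ K.outputProb P G' :=
  ENNReal.tsum_le_tsum fun _ => mul_le_mul_right (MeasureTheory.measure_mono h) _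

variable [Fintype S]

theorem move_none_add_sum (h : List (S × A × S)) :
    (K.move h none).toReal + ∑ q, (K.move h (some q)).toReal = 1 := by
  rw [← sum_pmf_toReal (K.move h), Fintype.sum_option]

theorem sum_reach_cons (h : List (S × A × S)) (F : S × A × S → ℝ) :
    ∑ x, K.reach P (x :: h) * F x =
      K.reach P h * ∑ q : S × A, (K.move h (some q)).toReal *
        ∑ s', (P q.1 q.2 s').toReal * F (q.1, q.2, s') := by
  rw [Fintype.sum_prod_type, Fintype.sum_prod_type, Finset.mul_sum]
  refine Finset.sum_congr rfl fun s _ => ?_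
  rw [Fintype.sum_prod_type, Finset.mul_sum]
  refine Finset.sum_congr rfl fun a _ => ?_
  rw [Finset.mul_sum, Finset.mul_sum]
  refine Finset.sum_congr rfl fun s' _ => ?_
  rw [reach_cons]
  ring

/-- The expectation of `F` at the history at which the algorithm stops or has taken `n` samples. -/
def truncExp (n : ℕ) (F : List (S × A × S) → ℝ) : ℝ :=
  ∑ h ∈ listsShorter _ n, K.reach P h * (K.move h none).toReal * F h +
    ∑ h ∈ listsOfLength _ n, K.reach P h * F h

theorem truncExp_mono (n : ℕ) {F G : List (S × A × S) → ℝ} (hFG : ∀ h, F h ≤ G h) :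
    K.truncExp P n F ≤ K.truncExp P n G := by
  refine add_le_add (Finset.sum_le_sum fun h _ => ?_) (Finset.sum_le_sum fun h _ => ?_)
  · exact mul_le_mul_of_nonneg_left (hFG h) (mul_nonneg (K.reach_nonneg P h) ENNReal.toReal_nonneg)
  · exact mul_le_mul_of_nonneg_left (hFG h) (K.reach_nonneg P h)

theorem truncExp_add (n : ℕ) (F G : List (S × A × S) → ℝ) :
    K.truncExp P n (fun h => F h + G h) = K.truncExp P n F + K.truncExp P n G := by
  simp only [truncExp, mul_add, Finset.sum_add_distrib]
  ring

theorem truncExp_const_mul (n : ℕ) (c : ℝ) (F : List (S × A × S) → ℝ) :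
    K.truncExp P n (fun h => c * F h) = c * K.truncExp P n F := by
  simp only [truncExp, mul_left_comm _ c, Finset.mul_sum, mul_add]

/-- Raising the truncation level changes only the runs still alive after `n` samples that ask for
one more; a run that stops there keeps its value `F h`. -/
theorem truncExp_succ (n : ℕ) (F : List (S × A × S) → ℝ) :
    K.truncExp P (n + 1) F = K.truncExp P n F +
      ∑ h ∈ listsOfLength _ n, K.reach P h * ∑ q : S × A, (K.move h (some q)).toReal *
        ∑ s', (P q.1 q.2 s').toReal * (F ((q.1, q.2, s') :: h) - F h) := by
  have key : ∀ h, K.reach P h * ∑ q : S × A, (K.move h (some q)).toReal *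
        ∑ s', (P q.1 q.2 s').toReal * (F ((q.1, q.2, s') :: h) - F h) =
      ∑ x, K.reach P (x :: h) * F (x :: h) -
        K.reach P h * (1 - (K.move h none).toReal) * F h := by
    intro h
    rw [K.sum_reach_cons P h (fun x => F (x :: h)), ← K.move_none_add_sum h, add_sub_cancel_left,
      mul_assoc, Finset.sum_mul, ← mul_sub, ← Finset.sum_sub_distrib]
    congr 1
    refine Finset.sum_congr rfl fun q _ => ?_
    simp only [mul_sub, Finset.sum_sub_distrib, ← Finset.sum_mul, sum_pmf_toReal, one_mul]
  rw [Finset.sum_congr rfl fun h _ => key h]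
  simp only [truncExp, sum_listsShorter, Finset.sum_range_succ, sum_listsOfLength_succ,
    Finset.sum_sub_distrib, sub_mul, mul_sub, mul_one]
  ring

theorem truncExp_const (n : ℕ) (c : ℝ) : K.truncExp P n (fun _ => c) = c := by
  induction n with
  | zero => simp [truncExp, listsShorter, listsOfLength, reach_nil]
  | succ n ih => simp [truncExp_succ, ih]

theorem sum_reach_mul_none_le_one (n : ℕ) :
    ∑ h ∈ listsShorter _ n, K.reach P h * (K.move h none).toReal ≤ 1 := by
  have h := K.truncExp_const P n 1
  simp only [truncExp, mul_one] at h
  linarith [Finset.sum_nonneg fun h (_ : h ∈ listsOfLength _ n) => K.reach_nonneg P h]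

theorem sum_reach_le_one (n : ℕ) : ∑ h ∈ listsOfLength _ n, K.reach P h ≤ 1 := by
  have h := K.truncExp_const P n 1
  simp only [truncExp, mul_one] at h
  linarith [Finset.sum_nonneg fun h (_ : h ∈ listsShorter _ n) =>
    mul_nonneg (K.reach_nonneg P h) (K.move h none).toReal_nonneg]

theorem sum_le_toReal_tsum {ι : Type} {f : ι → ℝ≥0∞} (hf : ∑' i, f i ≠ ∞) (s : Finset ι) :
    ∑ i ∈ s, (f i).toReal ≤ (∑' i, f i).toReal := by
  rw [← ENNReal.toReal_sum fun i _ => ENNReal.ne_top_of_tsum_ne_top hf i]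
  exact ENNReal.toReal_mono hf (ENNReal.sum_le_tsum s)

theorem tsum_stop_le_one : ∑' h, K.reachProb P h * K.move h none ≤ 1 := by
  refine ENNReal.summable.tsum_le_of_sum_le fun s => ?_
  obtain ⟨n, hn⟩ := exists_subset_listsShorter s
  have hne : ∀ h, K.reachProb P h * K.move h none ≠ ∞ := fun h =>
    ENNReal.mul_ne_top (K.reachProb_ne_top P h) (PMF.apply_ne_top _ _)
  refine (Finset.sum_le_sum_of_subset hn).trans ?_
  rw [← ENNReal.toReal_le_toReal (ENNReal.sum_ne_top.2 fun h _ => hne h) ENNReal.one_ne_top,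
    ENNReal.toReal_sum fun h _ => hne h, ENNReal.toReal_one]
  simp only [ENNReal.toReal_mul]
  exact K.sum_reach_mul_none_le_one P n

theorem outputProb_add_compl {G : Set (Policy S A)} (hG : MeasurableSet G) :
    K.outputProb P G + K.outputProb P Gᶜ ≤ 1 := by
  rw [outputProb, outputProb, ← ENNReal.tsum_add]
  refine le_of_eq_of_le (tsum_congr fun h => ?_) (K.tsum_stop_le_one P)
  have := K.output_prob h
  rw [← mul_add, MeasureTheory.prob_add_prob_compl hG, mul_one]

theorem outputProb_le_one (G : Set (Policy S A)) : K.outputProb P G ≤ 1 := by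
  refine (ENNReal.tsum_le_tsum fun h => ?_).trans (K.tsum_stop_le_one P)
  have := K.output_prob h
  exact mul_le_of_le_one_right' MeasureTheory.prob_le_one

theorem outputProb_compl_le {G : Set (Policy S A)} (hG : MeasurableSet G) {δ : ℝ}
    (h : ENNReal.ofReal (1 - δ) ≤ K.outputProb P G) : (K.outputProb P Gᶜ).toReal ≤ δ := by
  have h1 := K.outputProb_add_compl P hG
  have hn : ∀ G, K.outputProb P G ≠ ∞ := fun G =>
    ne_top_of_le_ne_top ENNReal.one_ne_top (K.outputProb_le_one P G)
  rw [← ENNReal.toReal_le_toReal (ENNReal.add_ne_top.2 ⟨hn _, hn _⟩) ENNReal.one_ne_top,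
    ENNReal.toReal_add (hn _) (hn _), ENNReal.toReal_one] at h1
  have h2 := (ENNReal.ofReal_le_iff_le_toReal (hn _)).1 h
  linarith

theorem sum_output_le (G : Set (Policy S A)) (s : Finset (List (S × A × S))) :
    ∑ h ∈ s, K.reach P h * (K.move h none).toReal * (K.output h G).toReal ≤
      (K.outputProb P G).toReal := by
  have := sum_le_toReal_tsum (ne_top_of_le_ne_top ENNReal.one_ne_top (K.outputProb_le_one P G)) s
  simp only [ENNReal.toReal_mul] at this
  exact this

/-- The expected number of samples that are taken from the pair `q`. -/
def pairSamples (q : S × A) : ℝ≥0∞ := ∑' h, K.reachProb P h * K.move h (some q)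

theorem expectedSamples_eq_sum : K.expectedSamples P = ∑ q, K.pairSamples P q := by
  simp only [expectedSamples, pairSamples, Finset.mul_sum]
  exact Summable.tsum_finsetSum fun _ _ => ENNReal.summable

theorem pairSamples_ne_top (hE : K.expectedSamples P ≠ ∞) (q : S × A) :
    K.pairSamples P q ≠ ∞ := by
  rw [expectedSamples_eq_sum] at hE
  exact ENNReal.sum_ne_top.1 hE q (Finset.mem_univ q)

/-- The tail probabilities of the sample count sum to its expectation, so they tend to `0` if this
is finite. -/
theorem tendsto_sum_reach (hE : K.expectedSamples P ≠ ∞) :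
    Filter.Tendsto (fun n => ∑ h ∈ listsOfLength _ n, K.reach P h) Filter.atTop (nhds 0) := by
  have hs : ∀ n, ∑ h ∈ listsOfLength _ (n + 1), K.reach P h =
      ∑ h ∈ listsOfLength _ n, K.reach P h * ∑ q, (K.move h (some q)).toReal := by
    intro n
    rw [sum_listsOfLength_succ]
    refine Finset.sum_congr rfl fun h _ => ?_
    simpa [sum_pmf_toReal] using K.sum_reach_cons P h fun _ => 1
  refine (Filter.tendsto_add_atTop_iff_nat 1).1 (Summable.tendsto_atTop_zero ?_)
  refine summable_of_sum_range_le (c := (K.expectedSamples P).toReal)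
    (fun n => Finset.sum_nonneg fun h _ => K.reach_nonneg P h) fun n => ?_
  simp only [hs, ← sum_listsShorter]
  have := sum_le_toReal_tsum hE (listsShorter _ n)
  simp only [ENNReal.toReal_mul,
    ENNReal.toReal_sum fun q _ => PMF.apply_ne_top _ (some q)] at this
  exact this

variable (P' : S → A → PMF S)

/-- The log-likelihood ratio of a history under the transition probabilities `P` and `P'`. -/
def logLikelihood : List (S × A × S) → ℝ
  | [] => 0
  | x :: h => logLikelihood h +
      Real.log ((P x.1 x.2.1 x.2.2).toReal / (P' x.1 x.2.1 x.2.2).toReal)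

variable {P P'}

omit [Fintype S] in
-- The moves of the algorithm have the same probabilities under both systems and cancel in the
-- likelihood ratio. Equal supports cover the histories of probability zero.
theorem reach_eq_mul_exp (hsupp : ∀ s a s', P s a s' = 0 ↔ P' s a s' = 0)
    (h : List (S × A × S)) :
    K.reach P' h = K.reach P h * Real.exp (-logLikelihood P P' h) := by
  induction h with
  | nil => simp [reach_nil, logLikelihood]
  | cons x h ih =>
    rw [reach_cons, reach_cons, ih, logLikelihood, neg_add, Real.exp_add]
    by_cases h0 : P x.1 x.2.1 x.2.2 = 0
    · simp [h0, (hsupp _ _ _).1 h0]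
    · have h1 : 0 < (P x.1 x.2.1 x.2.2).toReal := ENNReal.toReal_pos h0 (PMF.apply_ne_top _ _)
      have h2 : 0 < (P' x.1 x.2.1 x.2.2).toReal :=
        ENNReal.toReal_pos (fun h => h0 ((hsupp _ _ _).2 h)) (PMF.apply_ne_top _ _)
      rw [← Real.log_inv, Real.exp_log (by positivity)]
      field_simp

omit [Fintype S] in
theorem sqrt_reach_mul (hsupp : ∀ s a s', P s a s' = 0 ↔ P' s a s' = 0)
    (h : List (S × A × S)) :
    √(K.reach P h) * √(K.reach P' h) =
      K.reach P h * Real.exp (-(1 / 2) * logLikelihood P P' h) := by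
  rw [reach_eq_mul_exp K hsupp, Real.sqrt_mul (K.reach_nonneg P h), ← mul_assoc,
    Real.mul_self_sqrt (K.reach_nonneg P h), ← Real.exp_half]
  congr 2
  ring

/-- A form of Wald's identity: each sample adds in conditional mean the divergence of the sampled
pair, which is at most `k` at `q` and at most `0` elsewhere. -/
theorem truncExp_logLikelihood_le {q : S × A} {k : ℝ} (hk : 0 ≤ k)
    (hKL : ∀ q', ∑ s', (P q'.1 q'.2 s').toReal *
      Real.log ((P q'.1 q'.2 s').toReal / (P' q'.1 q'.2 s').toReal) ≤
        ({q} : Set (S × A)).indicator (fun _ => k) q')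
    (hE : K.expectedSamples P ≠ ∞) (n : ℕ) :
    K.truncExp P n (logLikelihood P P') ≤ k * (K.pairSamples P q).toReal := by
  classical
  have h1 : K.truncExp P n (logLikelihood P P') ≤
      ∑ h ∈ listsShorter _ n, k * (K.reach P h * (K.move h (some q)).toReal) := by
    induction n with
    | zero => simp [truncExp, listsShorter, listsOfLength, logLikelihood]
    | succ n ih =>
      rw [truncExp_succ, sum_listsShorter, Finset.sum_range_succ, ← sum_listsShorter]
      refine add_le_add ih (Finset.sum_le_sum fun h _ => ?_)
      rw [mul_left_comm]
      refine mul_le_mul_of_nonneg_left ?_ (K.reach_nonneg P h)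
      calc _ ≤ ∑ q', (K.move h (some q')).toReal * ({q} : Set (S × A)).indicator (fun _ => k) q' := by
            refine Finset.sum_le_sum fun q' _ => mul_le_mul_of_nonneg_left ?_ ENNReal.toReal_nonneg
            simpa only [logLikelihood, add_sub_cancel_left] using hKL q'
        _ = _ := by simp [Set.indicator_apply, mul_comm]
  refine h1.trans ?_
  rw [← Finset.mul_sum]
  refine mul_le_mul_of_nonneg_left ?_ hk
  have := sum_le_toReal_tsum (K.pairSamples_ne_top P hE q) (listsShorter _ n)
  simp only [ENNReal.toReal_mul] at this
  exact this

/-- Jensen's inequality, from the tangent line of `exp` at the mean and the fact that the truncated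
law has total mass `1`. -/
theorem exp_le_truncExp (n : ℕ) (l : List (S × A × S) → ℝ) :
    Real.exp (-(1 / 2) * K.truncExp P n l) ≤
      K.truncExp P n fun h => Real.exp (-(1 / 2) * l h) := by
  set D := K.truncExp P n l with hD
  have h1 : (1 : ℝ) ≤ K.truncExp P n fun h => Real.exp (1 / 2 * D) * Real.exp (-(1 / 2) * l h) := by
    calc (1 : ℝ) = K.truncExp P n fun h => (1 + 1 / 2 * D) + -(1 / 2) * l h := by
          rw [truncExp_add, truncExp_const, truncExp_const_mul, ← hD]
          ring
      _ ≤ _ := by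
          refine K.truncExp_mono P n fun h => ?_
          rw [← Real.exp_add]
          linarith [Real.add_one_le_exp (1 / 2 * D + -(1 / 2) * l h)]
  rw [truncExp_const_mul] at h1
  have h2 := mul_le_mul_of_nonneg_left h1 (Real.exp_pos (-(1 / 2) * D)).le
  rwa [mul_one, ← mul_assoc, ← Real.exp_add, neg_mul, neg_add_cancel, Real.exp_zero, one_mul,
    ← neg_mul] at h2

/-- Split the affinity of the stopped runs according to whether the output lies in `G`. By
Cauchy–Schwarz each part is at most `√δ`: outputs in `G` are rare under `P'`, the others are rare
under `P`. -/
theorem affinity_le {G G' : Set (Policy S A)} (hG : MeasurableSet G) (hG' : MeasurableSet G')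
    (hdisj : Disjoint G G') {δ : ℝ}
    (hP : ENNReal.ofReal (1 - δ) ≤ K.outputProb P G)
    (hP' : ENNReal.ofReal (1 - δ) ≤ K.outputProb P' G') (s : Finset (List (S × A × S))) :
    ∑ h ∈ s, √(K.reach P h) * √(K.reach P' h) * (K.move h none).toReal ≤ 2 * √δ := by
  have hle : ∀ (P : S → A → PMF S) (G : Set (Policy S A)), (K.outputProb P G).toReal ≤ 1 :=
    fun P G => ENNReal.toReal_le_of_le_ofReal zero_le_one (by simpa using K.outputProb_le_one P G)
  have h1 : (K.outputProb P' G).toReal ≤ δ :=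
    (ENNReal.toReal_mono (ne_top_of_le_ne_top ENNReal.one_ne_top (K.outputProb_le_one _ _))
      (K.outputProb_mono P' hdisj.subset_compl_right)).trans (K.outputProb_compl_le P' hG' hP')
  have h2 : (K.outputProb P Gᶜ).toReal ≤ δ := K.outputProb_compl_le P hG hP
  have key : ∀ E : Set (Policy S A), ∑ h ∈ s, √(K.reach P h * (K.move h none).toReal *
      (K.output h E).toReal) * √(K.reach P' h * (K.move h none).toReal * (K.output h E).toReal) ≤
        √(K.outputProb P E).toReal * √(K.outputProb P' E).toReal := by
    intro E
    refine (Real.sum_sqrt_mul_sqrt_le s (fun h => ?_) fun h => ?_).trans ?_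
    · exact mul_nonneg (mul_nonneg (K.reach_nonneg _ h) ENNReal.toReal_nonneg) ENNReal.toReal_nonneg
    · exact mul_nonneg (mul_nonneg (K.reach_nonneg _ h) ENNReal.toReal_nonneg) ENNReal.toReal_nonneg
    · exact mul_le_mul (Real.sqrt_le_sqrt (K.sum_output_le P E s))
        (Real.sqrt_le_sqrt (K.sum_output_le P' E s)) (Real.sqrt_nonneg _) (Real.sqrt_nonneg _)
  -- The stopping and output laws depend on the history alone, so they enter both square roots
  -- equally and come out as plain factors.
  have hsplit : ∀ h, √(K.reach P h) * √(K.reach P' h) * (K.move h none).toReal =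
      √(K.reach P h * (K.move h none).toReal * (K.output h G).toReal) *
        √(K.reach P' h * (K.move h none).toReal * (K.output h G).toReal) +
      √(K.reach P h * (K.move h none).toReal * (K.output h Gᶜ).toReal) *
        √(K.reach P' h * (K.move h none).toReal * (K.output h Gᶜ).toReal) := by
    intro h
    have hr : ∀ E : Set (Policy S A), √(K.reach P h * (K.move h none).toReal * (K.output h E).toReal) *
        √(K.reach P' h * (K.move h none).toReal * (K.output h E).toReal) =
        √(K.reach P h) * √(K.reach P' h) * (K.move h none).toReal * (K.output h E).toReal := by
      intro E
      have hm : 0 ≤ (K.move h none).toReal * (K.output h E).toReal :=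
        mul_nonneg ENNReal.toReal_nonneg ENNReal.toReal_nonneg
      rw [mul_assoc, mul_assoc, Real.sqrt_mul (K.reach_nonneg _ h),
        Real.sqrt_mul (K.reach_nonneg _ h), mul_mul_mul_comm, Real.mul_self_sqrt hm, mul_assoc,
        mul_assoc, mul_assoc]
    have := K.output_prob h
    have h1 : (K.output h G).toReal + (K.output h Gᶜ).toReal = 1 := by
      rw [← ENNReal.toReal_add (MeasureTheory.measure_ne_top _ _)
        (MeasureTheory.measure_ne_top _ _), MeasureTheory.prob_add_prob_compl hG,
        ENNReal.toReal_one]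
    rw [hr, hr, ← mul_add, h1, mul_one]
  simp only [hsplit, Finset.sum_add_distrib]
  have k1 : √(K.outputProb P G).toReal * √(K.outputProb P' G).toReal ≤ 1 * √δ :=
    mul_le_mul (Real.sqrt_le_one.2 (hle _ _)) (Real.sqrt_le_sqrt h1) (Real.sqrt_nonneg _)
      zero_le_one
  have k2 : √(K.outputProb P Gᶜ).toReal * √(K.outputProb P' Gᶜ).toReal ≤ √δ * 1 :=
    mul_le_mul (Real.sqrt_le_sqrt h2) (Real.sqrt_le_one.2 (hle _ _)) (Real.sqrt_nonneg _)
      (Real.sqrt_nonneg _)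
  linarith [key G, key Gᶜ]

/-- The change of measure inequality: an algorithm that has to tell apart two systems of transition
probabilities that differ at the pair `q` only has to sample from `q`. -/
theorem log_le_mul_pairSamples (hsupp : ∀ s a s', P s a s' = 0 ↔ P' s a s' = 0)
    {q : S × A} {k : ℝ} (hk : 0 ≤ k)
    (hKL : ∀ q', ∑ s', (P q'.1 q'.2 s').toReal *
      Real.log ((P q'.1 q'.2 s').toReal / (P' q'.1 q'.2 s').toReal) ≤
        ({q} : Set (S × A)).indicator (fun _ => k) q')
    {G G' : Set (Policy S A)} (hG : MeasurableSet G) (hG' : MeasurableSet G')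
    (hdisj : Disjoint G G') {δ : ℝ} (hδ : 0 < δ)
    (hP : ENNReal.ofReal (1 - δ) ≤ K.outputProb P G)
    (hP' : ENNReal.ofReal (1 - δ) ≤ K.outputProb P' G') (hE : K.expectedSamples P ≠ ∞) :
    Real.log (1 / (4 * δ)) ≤ k * (K.pairSamples P q).toReal := by
  have h1 : ∀ n, Real.exp (-(1 / 2) * (k * (K.pairSamples P q).toReal)) ≤
      2 * √δ + √(∑ h ∈ listsOfLength _ n, K.reach P h) := by
    intro n
    calc _ ≤ Real.exp (-(1 / 2) * K.truncExp P n (logLikelihood P P')) :=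
          Real.exp_le_exp.2 (by linarith [K.truncExp_logLikelihood_le hk hKL hE n])
      _ ≤ _ := K.exp_le_truncExp n _
      _ ≤ _ := by
          refine add_le_add ?_ ?_
          · refine le_of_eq_of_le (Finset.sum_congr rfl fun h _ => ?_)
              (K.affinity_le hG hG' hdisj hP hP' (listsShorter _ n))
            rw [K.sqrt_reach_mul hsupp, mul_right_comm]
          · simp only [← K.sqrt_reach_mul hsupp]
            refine (Real.sum_sqrt_mul_sqrt_le _ (K.reach_nonneg P) (K.reach_nonneg P')).trans ?_
            exact mul_le_of_le_one_right (Real.sqrt_nonneg _)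
              (Real.sqrt_le_one.2 (K.sum_reach_le_one P' n))
  -- As `n` grows, the contribution of the runs that have not stopped vanishes.
  have h2 : Real.exp (-(1 / 2) * (k * (K.pairSamples P q).toReal)) ≤ 2 * √δ := by
    refine ge_of_tendsto' (f := fun n => 2 * √δ + √(∑ h ∈ listsOfLength _ n, K.reach P h))
      (x := Filter.atTop) ?_ h1
    simpa using ((K.tendsto_sum_reach P hE).sqrt).const_add (2 * √δ)
  have h3 : -(1 / 2) * (k * (K.pairSamples P q).toReal) ≤ Real.log (2 * √δ) :=
    (Real.le_log_iff_exp_le (by positivity)).2 h2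
  have h4 : Real.log (1 / (4 * δ)) = -2 * Real.log (2 * √δ) := by
    have : 4 * δ = (2 * √δ) ^ 2 := by rw [mul_pow, Real.sq_sqrt hδ.le]; norm_num
    rw [this, one_div, Real.log_inv, Real.log_pow]
    push_cast
    ring
  rw [h4]
  linarith

end GenAlgorithm

/-! ### Two-point distributions -/

section TwoPoint

variable {σ : Type} [Fintype σ] [DecidableEq σ]

/-- The mass function that gives `t` to `x` and `1 - t` to `y`. -/
def twoPointMass (x y : σ) (t : unitInterval) (z : σ) : ℝ :=
  (if z = x then (t : ℝ) else 0) + (if z = y then 1 - (t : ℝ) else 0)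

omit [Fintype σ] in
theorem twoPointMass_nonneg (x y : σ) (t : unitInterval) (z : σ) : 0 ≤ twoPointMass x y t z := by
  have h0 := t.2.1
  have h1 := t.2.2
  unfold twoPointMass
  split_ifs <;> linarith

theorem sum_twoPointMass_mul (x y : σ) (t : unitInterval) (f : σ → ℝ) :
    ∑ z, twoPointMass x y t z * f z = t * f x + (1 - t) * f y := by
  simp [twoPointMass, add_mul, Finset.sum_add_distrib]

theorem sum_twoPointMass (x y : σ) (t : unitInterval) : ∑ z, twoPointMass x y t z = 1 := by
  simpa using sum_twoPointMass_mul x y t fun _ => 1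

/-- The distribution that gives `t` to `x` and `1 - t` to `y`. -/
def twoPointPMF (x y : σ) (t : unitInterval) : PMF σ :=
  PMF.ofFintype (fun z => ENNReal.ofReal (twoPointMass x y t z)) (by
    rw [← ENNReal.ofReal_sum_of_nonneg fun z _ => twoPointMass_nonneg x y t z, sum_twoPointMass,
      ENNReal.ofReal_one])

theorem twoPointPMF_apply_toReal (x y : σ) (t : unitInterval) (z : σ) :
    (twoPointPMF x y t z).toReal = twoPointMass x y t z :=
  ENNReal.toReal_ofReal (twoPointMass_nonneg x y t z)

/-- The element of the simplex that gives `t` to `x` and `1 - t` to `y`. -/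
def twoPointSimplex (x y : σ) (t : unitInterval) : stdSimplex ℝ σ :=
  ⟨twoPointMass x y t, twoPointMass_nonneg x y t, sum_twoPointMass x y t⟩

end TwoPoint

/-! ### Discounted reach probabilities in the binary tree -/

section BinaryReach

/-- The discounted probability to reach the node `n` of the infinite binary tree with root `1`, in
which the children of `n` are `2 * n` and `2 * n + 1`, if `e n` is the probability to go from `n`
to `2 * n`. -/
def binaryReach (γ : ℝ) (e : ℕ → ℝ) (n : ℕ) : ℝ :=
  if n = 0 then 0 else if n = 1 then 1 else
    γ * (binaryReach γ e (n / 2) * if n % 2 = 0 then e (n / 2) else 1 - e (n / 2))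
termination_by n
decreasing_by omega

variable {γ : ℝ} {e : ℕ → ℝ}

theorem binaryReach_zero : binaryReach γ e 0 = 0 := by rw [binaryReach]; rfl

theorem binaryReach_one : binaryReach γ e 1 = 1 := by rw [binaryReach]; rfl

theorem binaryReach_of_two_le {n : ℕ} (hn : 2 ≤ n) : binaryReach γ e n =
    γ * (binaryReach γ e (n / 2) * if n % 2 = 0 then e (n / 2) else 1 - e (n / 2)) := by
  rw [binaryReach, if_neg (by omega), if_neg (by omega)]

theorem binaryReach_nonneg (hγ : 0 ≤ γ) (he : ∀ n, e n ∈ Set.Icc (0 : ℝ) 1) (n : ℕ) :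
    0 ≤ binaryReach γ e n := by
  induction n using Nat.strong_induction_on with
  | _ n ih =>
    rcases lt_or_ge n 2 with hn | hn
    · interval_cases n
      · exact binaryReach_zero.ge
      · exact zero_le_one.trans binaryReach_one.ge
    · rw [binaryReach_of_two_le hn]
      refine mul_nonneg hγ (mul_nonneg (ih _ (by omega)) ?_)
      split_ifs
      · exact (he _).1
      · exact sub_nonneg.2 (he _).2

theorem binaryReach_congr {e' : ℕ → ℝ} {n : ℕ} (h : ∀ m, 1 ≤ m → m < n → 2 * m ≤ n → e m = e' m) :
    binaryReach γ e n = binaryReach γ e' n := by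
  induction n using Nat.strong_induction_on with
  | _ n ih =>
    rcases lt_or_ge n 2 with hn | hn
    · interval_cases n
      · rw [binaryReach_zero, binaryReach_zero]
      · rw [binaryReach_one, binaryReach_one]
    · rw [binaryReach_of_two_le hn, binaryReach_of_two_le hn, h (n / 2) (by omega) (by omega)
        (by omega), ih (n / 2) (by omega) fun m h1 h2 h3 => h m h1 (by omega) (by omega)]

theorem sum_Ico_two_mul (f : ℕ → ℝ) {a b : ℕ} (hab : a ≤ b) :
    ∑ n ∈ Finset.Ico (2 * a) (2 * b), f n = ∑ n ∈ Finset.Ico a b, (f (2 * n) + f (2 * n + 1)) := by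
  induction b, hab using Nat.le_induction with
  | base => simp
  | succ b hab ih =>
    rw [Finset.sum_Ico_succ_top hab, ← ih, mul_add, mul_one, Finset.sum_Ico_succ_top (by omega),
      Finset.sum_Ico_succ_top (by omega), add_assoc]

/-- Each node passes all its mass, discounted once, to its two children, whatever `e` is. -/
theorem sum_binaryReach (k : ℕ) :
    ∑ n ∈ Finset.Ico (2 ^ k) (2 ^ (k + 1)), binaryReach γ e n = γ ^ k := by
  induction k with
  | zero => simp [binaryReach_one]
  | succ k ih =>
    rw [pow_succ' 2 k, pow_succ' 2 (k + 1), sum_Ico_two_mul _ (Nat.pow_le_pow_right two_pos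
      (Nat.le_succ k)), pow_succ' γ, ← ih, Finset.mul_sum]
    refine Finset.sum_congr rfl fun n hn => ?_
    have hn1 : 1 ≤ n := Nat.one_le_two_pow.trans (Finset.mem_Ico.1 hn).1
    rw [binaryReach_of_two_le (n := 2 * n) (by omega),
      binaryReach_of_two_le (n := 2 * n + 1) (by omega), show 2 * n / 2 = n by omega,
      show (2 * n + 1) / 2 = n by omega, if_pos (by omega), if_neg (by omega)]
    ring

/-- The binary digits of `x` spell the path from the root, and `e` is chosen to follow it
deterministically. -/
theorem exists_binaryReach_eq (γ : ℝ) (k : ℕ) {x : ℕ} (hx : x ∈ Set.Ico (2 ^ k) (2 ^ (k + 1))) :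
    ∃ e : ℕ → unitInterval, binaryReach γ (fun n => e n) x = γ ^ k := by
  induction k generalizing x with
  | zero =>
    have hx1 : x = 1 := by have := hx.1; have := hx.2; omega
    exact ⟨fun _ => 0, by rw [hx1, binaryReach_one, pow_zero]⟩
  | succ k ih =>
    have h1 : 2 * 2 ^ k ≤ x := by rw [← pow_succ']; exact hx.1
    have h2 : x < 2 * 2 ^ (k + 1) := by rw [← pow_succ']; exact hx.2
    have h3 : 1 ≤ 2 ^ k := Nat.one_le_two_pow
    obtain ⟨e, he⟩ := ih (x := x / 2) ⟨by omega, by omega⟩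
    refine ⟨Function.update e (x / 2) (if x % 2 = 0 then 1 else 0), ?_⟩
    rw [binaryReach_of_two_le (by omega), binaryReach_congr (e' := fun n => (e n : ℝ)), he,
      pow_succ']
    · split_ifs <;> simp
    · intro m _ hm _
      rw [Function.update_of_ne hm.ne]

end BinaryReach

/-! ### Occupancies and values in tree-shaped models -/

/-- A complete binary tree inside `Fin S`: its nodes are the numbers `n` with
`1 ≤ n < 2 ^ (depth + 1)`, the root is `1`, and the children of `n` are `2 * n` and `2 * n + 1`. -/
structure HeapTree (S A : ℕ) where
  depth : ℕ
  size_le : 2 ^ (depth + 1) ≤ S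
  two_le : 2 ≤ A

namespace HeapTree

variable {S A : ℕ} (T : HeapTree S A)

theorem one_lt (T : HeapTree S A) : 1 < S :=
  lt_of_lt_of_le (Nat.one_lt_two_pow (Nat.succ_ne_zero _)) T.size_le

def sink : Fin S := ⟨0, T.one_lt.trans' one_pos⟩

def root : Fin S := ⟨1, T.one_lt⟩

/-- The action that goes to the left child. -/
def left : Fin A := ⟨0, zero_lt_two.trans_le T.two_le⟩

/-- An action that goes to the right child. -/
def right : Fin A := ⟨1, T.two_le⟩

theorem right_ne_left : T.right ≠ T.left := by simp [left, right]

def IsInner (s : Fin S) : Prop := 1 ≤ s.1 ∧ s.1 < 2 ^ T.depth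

def IsLeaf (s : Fin S) : Prop := 2 ^ T.depth ≤ s.1 ∧ s.1 < 2 ^ (T.depth + 1)

instance : DecidablePred T.IsInner := fun _ => inferInstanceAs (Decidable (_ ∧ _))

instance : DecidablePred T.IsLeaf := fun _ => inferInstanceAs (Decidable (_ ∧ _))

variable {T} in
theorem IsLeaf.not_isInner {s : Fin S} (h : T.IsLeaf s) : ¬ T.IsInner s :=
  fun h' => (h'.2.trans_le h.1).false

def leaves : Finset (Fin S) := Finset.univ.filter T.IsLeaf

theorem mem_leaves {s : Fin S} : s ∈ T.leaves ↔ T.IsLeaf s := by simp [leaves]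

theorem sum_leaves (f : ℕ → ℝ) :
    ∑ s ∈ T.leaves, f s = ∑ n ∈ Finset.Ico (2 ^ T.depth) (2 ^ (T.depth + 1)), f n := by
  refine Finset.sum_nbij Fin.val (fun s hs => Finset.mem_Ico.2 (T.mem_leaves.1 hs))
    Fin.val_injective.injOn (fun n hn => ?_) fun _ _ => rfl
  have hn := Finset.mem_Ico.1 hn
  exact ⟨⟨n, hn.2.trans_le T.size_le⟩, T.mem_leaves.2 hn, rfl⟩

theorem card_leaves : (T.leaves.card : ℝ) = 2 ^ T.depth := by
  have h := T.sum_leaves fun _ => 1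
  simp only [Finset.sum_const, nsmul_eq_mul, mul_one, Nat.card_Ico] at h
  rw [h, pow_succ]
  have : 2 ^ T.depth * 2 - 2 ^ T.depth = 2 ^ T.depth := by omega
  rw [this]
  norm_num

/-- The state to which the action `a` tries to go: a child of an inner node, the state itself for a
leaf, and the sink otherwise. -/
def next (s : Fin S) (a : Fin A) : Fin S :=
  if h : T.IsInner s then
    ⟨2 * s + if a = T.left then 0 else 1, by
      have h1 := h.2
      have h2 := T.size_le
      rw [pow_succ] at h2
      split_ifs <;> omega⟩
  else if T.IsLeaf s then s else T.sink

/-- The transition probabilities that stay at the leaf `s` with probability `stay s a` and go to the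
sink otherwise, and are deterministic at the other states. -/
def transition (stay : Fin S → Fin A → unitInterval) (s : Fin S) (a : Fin A) : PMF (Fin S) :=
  twoPointPMF (T.next s a) T.sink (if T.IsLeaf s then stay s a else 1)

/-- The reward `x` for the action `left` and `y` for the other actions at the leaves. -/
def leafReward (x y : ℝ) (s : Fin S) (a : Fin A) : ℝ :=
  if T.IsLeaf s then if a = T.left then x else y else 0

theorem leafReward_mem {x y : ℝ} (hx : x ∈ Set.Icc (0 : ℝ) 1) (hy : y ∈ Set.Icc (0 : ℝ) 1)
    (s : Fin S) (a : Fin A) : T.leafReward x y s a ∈ Set.Icc (0 : ℝ) 1 := by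
  unfold leafReward
  split_ifs
  exacts [hx, hy, ⟨le_rfl, zero_le_one⟩]

/-- The probability with which a policy goes left at the state `n`. -/
def leftProb (π : Policy (Fin S) (Fin A)) (n : ℕ) : ℝ :=
  if h : n < S then π ⟨n, h⟩ T.left else 0

theorem policy_nonneg (π : Policy (Fin S) (Fin A)) (s : Fin S) (a : Fin A) : 0 ≤ π s a :=
  (π s).2.1 a

theorem policy_le_one (π : Policy (Fin S) (Fin A)) (s : Fin S) (a : Fin A) : π s a ≤ 1 := by
  have h : π s a ≤ ∑ a, π s a :=
    Finset.single_le_sum (f := fun a => π s a) (fun a _ => (π s).2.1 a) (Finset.mem_univ a)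
  exact h.trans_eq (π s).2.2

theorem leftProb_mem (π : Policy (Fin S) (Fin A)) (n : ℕ) :
    T.leftProb π n ∈ Set.Icc (0 : ℝ) 1 := by
  unfold leftProb
  split_ifs with h
  · exact ⟨(π _).2.1 _, policy_le_one π _ _⟩
  · exact ⟨le_rfl, zero_le_one⟩

theorem leftProb_val (π : Policy (Fin S) (Fin A)) (s : Fin S) :
    T.leftProb π s = π s T.left := by
  simp [leftProb]

theorem sum_policy_ite (π : Policy (Fin S) (Fin A)) (s : Fin S) (x y : ℝ) :
    ∑ a, π s a * (if a = T.left then x else y) = x + (y - x) * (1 - π s T.left) := by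
  have h : ∀ a, π s a * (if a = T.left then x else y) =
      π s a * y + if a = T.left then π s a * (x - y) else 0 := by
    intro a
    split_ifs <;> ring
  have h1 : ∑ a, π s a = 1 := (π s).2.2
  simp only [h, Finset.sum_add_distrib, ← Finset.sum_mul, h1, Finset.sum_ite_eq',
    Finset.mem_univ, if_true]
  ring

section Occupancy

variable {T}
variable {M : CMDP (Fin S) (Fin A)} {stay : Fin S → Fin A → unitInterval}
  (hP : M.P = T.transition stay) (hρ : M.ρ = PMF.pure T.root) (π : Policy (Fin S) (Fin A))

include hP hρ

theorem occupancy_eq_add {s : Fin S} (hs : s ≠ T.sink) :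
    M.occupancy π s = (if s.1 = 1 then 1 else 0) + M.γ * ∑ s', M.occupancy π s' *
      ∑ a, π s' a * if T.next s' a = s then (if T.IsLeaf s' then (stay s' a : ℝ) else 1) else 0 := by
  rw [M.occupancy_eq, hρ, PMF.pure_apply]
  congr 1
  · simp only [root, Fin.ext_iff]
    split_ifs <;> simp
  · congr 1
    refine Finset.sum_congr rfl fun s' _ => ?_
    rw [Finset.mul_sum]
    refine Finset.sum_congr rfl fun a _ => ?_
    rw [hP, transition, twoPointPMF_apply_toReal, twoPointMass, if_neg hs, add_zero, mul_assoc]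
    simp only [eq_comm (a := s)]
    split_ifs <;> simp

theorem occupancy_node {s : Fin S} (h1 : 1 ≤ s.1) (h2 : s.1 < 2 ^ (T.depth + 1)) :
    M.occupancy π s = (if s.1 = 1 then 1 else M.γ * (M.occupancy π ⟨s / 2, by omega⟩ *
      if s.1 % 2 = 0 then T.leftProb π (s / 2) else 1 - T.leftProb π (s / 2))) +
      if T.IsLeaf s then M.γ * (M.occupancy π s * ∑ a, π s a * stay s a) else 0 := by
  have hs : s ≠ T.sink := fun h => by simp [h, sink] at h1
  have h2' : s.1 < 2 * 2 ^ T.depth := by rwa [pow_succ'] at h2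
  set s₁ : Fin S := ⟨s / 2, by omega⟩ with hs₁
  have hne : s₁ ≠ s := by
    simp only [hs₁, ne_eq, Fin.ext_iff]
    omega
  refine (occupancy_eq_add hP hρ π hs).trans ?_
  -- Mass can enter a node only from its parent `s / 2` or, at a leaf, from the node itself.
  rw [Finset.sum_eq_add s₁ s hne]
  · have hself : M.γ * (M.occupancy π s * ∑ a, π s a *
        if T.next s a = s then (if T.IsLeaf s then (stay s a : ℝ) else 1) else 0) =
        if T.IsLeaf s then M.γ * (M.occupancy π s * ∑ a, π s a * stay s a) else 0 := by
      by_cases hl : T.IsLeaf s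
      · simp [next, hl, hl.not_isInner]
      · have hi : T.IsInner s := ⟨h1, by by_contra h; exact hl ⟨not_lt.1 h, h2⟩⟩
        have : ∀ a, T.next s a ≠ s := by
          intro a
          simp only [next, dif_pos hi, ne_eq, Fin.ext_iff]
          omega
        simp [this, hl]
    rw [mul_add, hself, ← add_assoc]
    congr 1
    by_cases hs1 : s.1 = 1
    -- The root has `1 / 2 = 0` as its formal parent. This is the sink, which is absorbing and
    -- contributes nothing.
    · have hs0 : s₁ = T.sink := by simp [hs₁, sink, hs1]
      have hn : ∀ a, T.next s₁ a ≠ s := by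
        intro a
        have hi : ¬ T.IsInner s₁ := by simp [hs0, IsInner, sink]
        have hl : ¬ T.IsLeaf s₁ := by simp [hs0, IsLeaf, sink]
        rw [next, dif_neg hi, if_neg hl]
        exact hs.symm
      simp [hs1, hn]
    · have hi : T.IsInner s₁ := ⟨by simp only [hs₁]; omega, by simp only [hs₁]; omega⟩
      have hl : ¬ T.IsLeaf s₁ := fun h => h.not_isInner hi
      have hnext : ∀ a, (π s₁ a * if T.next s₁ a = s then
          (if T.IsLeaf s₁ then (stay s₁ a : ℝ) else 1) else 0) =
          π s₁ a * if a = T.left then (if s.1 % 2 = 0 then 1 else 0)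
            else (if s.1 % 2 = 0 then 0 else 1) := by
        intro a
        congr 1
        simp only [next, dif_pos hi, if_neg hl, Fin.ext_iff]
        simp only [hs₁]
        split_ifs <;> first | rfl | omega
      rw [if_neg hs1, if_neg hs1, zero_add, Finset.sum_congr rfl fun a _ => hnext a,
        T.sum_policy_ite, ← T.leftProb_val]
      simp only [hs₁]
      split_ifs <;> ring
  · intro s' _ hs'
    have : ∀ a, T.next s' a ≠ s := by
      intro a
      unfold next
      split_ifs with hi hl
      · intro h
        refine hs'.1 ?_
        simp only [hs₁, Fin.ext_iff] at h ⊢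
        omega
      · intro h
        refine hs'.1 ?_
        simp only [hs₁, Fin.ext_iff] at h ⊢
        omega
      · exact hs'.2
      · exact hs.symm
    simp [this]
  · exact fun h => absurd (Finset.mem_univ _) h
  · exact fun h => absurd (Finset.mem_univ _) h

theorem occupancy_inner {s : Fin S} (hs : T.IsInner s) :
    M.occupancy π s = binaryReach M.γ (T.leftProb π) s := by
  obtain ⟨n, hn⟩ := s
  induction n using Nat.strong_induction_on with
  | _ n ih =>
    have h2 : n < 2 ^ (T.depth + 1) := hs.2.trans (Nat.pow_lt_pow_right one_lt_two (Nat.lt_succ_self _))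
    have h1 : 1 ≤ n := hs.1
    have hl : ¬ T.IsLeaf ⟨n, hn⟩ := fun h => h.not_isInner hs
    rw [occupancy_node hP hρ π h1 h2, if_neg hl, add_zero]
    simp only
    split_ifs with h
    · rw [h, binaryReach_one]
    · have := hs.2
      rw [ih (n / 2) (by omega) (by omega) ⟨by simp only; omega, by simp only at this ⊢; omega⟩,
        binaryReach_of_two_le (n := n) (by omega), if_pos (by assumption)]
    · have := hs.2
      rw [ih (n / 2) (by omega) (by omega) ⟨by simp only; omega, by simp only at this ⊢; omega⟩,
        binaryReach_of_two_le (n := n) (by omega), if_neg (by assumption)]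

/-- The self-loop at a leaf makes the flow balance a geometric series in the mean staying
probability. -/
theorem occupancy_leaf {s : Fin S} (hs : T.IsLeaf s) :
    M.occupancy π s * (1 - M.γ * ∑ a, π s a * stay s a) =
      binaryReach M.γ (T.leftProb π) s := by
  have h1 : 1 ≤ s.1 := Nat.one_le_two_pow.trans hs.1
  have h := occupancy_node hP hρ π h1 hs.2
  rw [if_pos hs] at h
  have h3 : (if s.1 = 1 then 1 else M.γ * (M.occupancy π ⟨s / 2, by omega⟩ *
      if s.1 % 2 = 0 then T.leftProb π (s / 2) else 1 - T.leftProb π (s / 2))) =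
      binaryReach M.γ (T.leftProb π) s := by
    split_ifs with h4 h5
    · rw [h4, binaryReach_one]
    all_goals
      have h6 : s.1 < 2 * 2 ^ T.depth := by rw [← pow_succ']; exact hs.2
      rw [occupancy_inner hP hρ π (s := ⟨s / 2, by omega⟩)
        ⟨by simp only; omega, by simp only; omega⟩, binaryReach_of_two_le (n := s) (by omega)]
      simp [h5]
  rw [h3] at h
  linarith

theorem value_leafReward (hstay : ∀ s a, M.γ * stay s a < 1) (x y : ℝ) :
    M.value (T.leafReward x y) π = ∑ s ∈ T.leaves, binaryReach M.γ (T.leftProb π) s *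
      (x + (y - x) * (1 - π s T.left)) / (1 - M.γ * ∑ a, π s a * stay s a) := by
  rw [M.value_eq_sum_occupancy, leaves, Finset.sum_filter]
  refine Finset.sum_congr rfl fun s _ => ?_
  split_ifs with hs
  · have h1 : M.γ * ∑ a, π s a * stay s a < 1 := by
      have h2 : ∑ a, π s a = 1 := (π s).2.2
      rw [Finset.mul_sum, ← h2]
      obtain ⟨a, ha⟩ : ∃ a, 0 < π s a := by
        by_contra! h
        have := Finset.sum_nonpos fun a (_ : a ∈ Finset.univ) => h a
        linarith
      refine Finset.sum_lt_sum (fun a _ => ?_) ⟨a, Finset.mem_univ a, ?_⟩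
      · rw [mul_left_comm]
        exact mul_le_of_le_one_right ((π s).2.1 a) (hstay s a).le
      · rw [mul_left_comm]
        exact mul_lt_of_lt_one_right ha (hstay s a)
    rw [eq_div_iff (by linarith), ← occupancy_leaf hP hρ π hs, ← T.sum_policy_ite]
    simp only [leafReward, if_pos hs, mul_assoc, ← Finset.mul_sum]
    ring
  · simp [leafReward, hs]

end Occupancy

end HeapTree

/-! ### Supports and divergence of two-point distributions -/

section TwoPoint

variable {σ : Type} [Fintype σ] [DecidableEq σ]

omit [Fintype σ] in
theorem twoPointMass_left {x y : σ} (hxy : x ≠ y) (t : unitInterval) :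
    twoPointMass x y t x = t := by
  simp [twoPointMass, hxy]

omit [Fintype σ] in
theorem twoPointMass_right {x y : σ} (hxy : x ≠ y) (t : unitInterval) :
    twoPointMass x y t y = 1 - t := by
  simp [twoPointMass, hxy.symm]

theorem twoPointPMF_eq_zero_iff (x y : σ) {t : unitInterval} (h0 : 0 < (t : ℝ))
    (h1 : (t : ℝ) < 1) (z : σ) : twoPointPMF x y t z = 0 ↔ z ≠ x ∧ z ≠ y := by
  have h : twoPointPMF x y t z = ENNReal.ofReal (twoPointMass x y t z) := rfl
  rw [h, ENNReal.ofReal_eq_zero, twoPointMass]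
  by_cases hx : z = x <;> by_cases hy : z = y <;> simp [hx, hy] <;> split_ifs <;> linarith

/-- The relative entropy is at most the χ²-divergence, by `log x ≤ x - 1`. -/
theorem sum_twoPointPMF_mul_log_le {x y : σ} (hxy : x ≠ y) {t t' : unitInterval}
    (h0 : 0 < (t : ℝ)) (h1 : (t : ℝ) < 1) (h0' : 0 < (t' : ℝ)) (h1' : (t' : ℝ) < 1) :
    ∑ z, (twoPointPMF x y t z).toReal *
      Real.log ((twoPointPMF x y t z).toReal / (twoPointPMF x y t' z).toReal) ≤
        (t' - t : ℝ) ^ 2 / (t' * (1 - t')) := by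
  simp only [twoPointPMF_apply_toReal]
  rw [sum_twoPointMass_mul, twoPointMass_left hxy, twoPointMass_left hxy, twoPointMass_right hxy,
    twoPointMass_right hxy]
  have e1 : 0 < 1 - (t : ℝ) := by linarith
  have e2 : 0 < 1 - (t' : ℝ) := by linarith
  have k1 := mul_le_mul_of_nonneg_left (Real.log_le_sub_one_of_pos (div_pos h0 h0')) h0.le
  have k2 := mul_le_mul_of_nonneg_left (Real.log_le_sub_one_of_pos (div_pos e1 e2)) e1.le
  refine (add_le_add k1 k2).trans_eq ?_
  field_simp
  ring

end TwoPoint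

/-! ### Test policies and hard transition probabilities -/

namespace HeapTree

variable {S A : ℕ} (T : HeapTree S A)

/-- The discounted probability that a policy reaches the node `s`. -/
def reach (γ : ℝ) (π : Policy (Fin S) (Fin A)) (s : Fin S) : ℝ := binaryReach γ (T.leftProb π) s

/-- The discounted probability that a policy does not play `left` at a leaf. -/
def riskMass (γ : ℝ) (π : Policy (Fin S) (Fin A)) : ℝ :=
  ∑ s ∈ T.leaves, T.reach γ π s * (1 - π s T.left)

section RiskMass

variable {γ : ℝ} (hγ : 0 ≤ γ) (π : Policy (Fin S) (Fin A))

theorem sum_reach : ∑ s ∈ T.leaves, T.reach γ π s = γ ^ T.depth :=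
  (T.sum_leaves (binaryReach γ (T.leftProb π))).trans (sum_binaryReach _)

include hγ

theorem reach_nonneg (s : Fin S) : 0 ≤ T.reach γ π s :=
  binaryReach_nonneg hγ (T.leftProb_mem π) _

theorem riskMass_nonneg : 0 ≤ T.riskMass γ π :=
  Finset.sum_nonneg fun s _ =>
    mul_nonneg (T.reach_nonneg hγ π s) (sub_nonneg.2 (policy_le_one π s _))

theorem reach_mul_le_riskMass {s : Fin S} (hs : T.IsLeaf s) :
    T.reach γ π s * (1 - π s T.left) ≤ T.riskMass γ π :=
  Finset.single_le_sum (f := fun s => T.reach γ π s * (1 - π s T.left)) (fun s _ =>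
    mul_nonneg (T.reach_nonneg hγ π s) (sub_nonneg.2 (policy_le_one π s _))) (T.mem_leaves.2 hs)

end RiskMass

theorem policy_le_one_sub (π : Policy (Fin S) (Fin A)) (s : Fin S) {a : Fin A} (ha : a ≠ T.left) :
    π s a ≤ 1 - π s T.left := by
  have h : ∑ b ∈ {a, T.left}, π s b ≤ ∑ b, π s b :=
    Finset.sum_le_sum_of_subset_of_nonneg (Finset.subset_univ _) fun b _ _ => (π s).2.1 b
  have h1 : ∑ b, π s b = 1 := (π s).2.2
  rw [Finset.sum_pair ha, h1] at h
  linarith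

theorem exists_policy_safe (γ : ℝ) : ∃ π : Policy (Fin S) (Fin A), T.riskMass γ π = 0 ∧
    ∀ s, ∀ a ≠ T.left, π s a = 0 := by
  have h : ∀ a, twoPointMass T.left T.left 1 a = if a = T.left then 1 else 0 := by
    intro a
    simp [twoPointMass]
  refine ⟨fun _ => twoPointSimplex T.left T.left 1, Finset.sum_eq_zero fun s _ => ?_,
    fun s a ha => (h a).trans (if_neg ha)⟩
  have h1 : (twoPointSimplex T.left T.left 1) T.left = 1 := (h _).trans (if_pos rfl)
  rw [h1, sub_self, mul_zero]

theorem exists_policy_target (γ : ℝ) {s : Fin S} (hs : T.IsLeaf s) {a : Fin A} (ha : a ≠ T.left)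
    (w : unitInterval) : ∃ π : Policy (Fin S) (Fin A), T.reach γ π s = γ ^ T.depth ∧
      T.riskMass γ π = w * γ ^ T.depth ∧ π s T.left = 1 - w ∧ π s a = w := by
  obtain ⟨e, he⟩ := exists_binaryReach_eq γ T.depth hs
  -- Walk straight to `s`. Mixing in the same way at all leaves makes the risk mass `w` times the
  -- total leaf mass, with no need to know that the other leaves are not reached.
  let π : Policy (Fin S) (Fin A) := fun s => if T.IsInner s then
    twoPointSimplex T.left T.right (e s) else twoPointSimplex a T.left w
  have hinner : ∀ s, T.IsInner s → π s T.left = e s := by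
    intro s hs
    simp only [π, if_pos hs]
    exact twoPointMass_left T.right_ne_left.symm _
  have hleft : ∀ s, T.IsLeaf s → π s T.left = 1 - w := by
    intro s hs
    simp only [π, if_neg hs.not_isInner]
    exact twoPointMass_right ha _
  refine ⟨π, ?_, ?_, hleft s hs, ?_⟩
  · rw [← he]
    refine binaryReach_congr fun m h1 h2 h3 => ?_
    have hm : m < S := h2.trans s.2
    have h4 := hs.2
    rw [pow_succ'] at h4
    exact (T.leftProb_val π ⟨m, hm⟩).trans (hinner ⟨m, hm⟩ ⟨h1, by simp only; omega⟩)
  · rw [riskMass, ← T.sum_reach π, Finset.mul_sum]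
    refine Finset.sum_congr rfl fun s hs => ?_
    rw [hleft s (T.mem_leaves.1 hs)]
    ring
  · simp only [π, if_neg hs.not_isInner]
    exact twoPointMass_left ha _

/-- The probability to stay at a leaf is `p'` for the pair `o` and `p` for the others. -/
def hardStay (p p' : unitInterval) (o : Option (Fin S × Fin A)) (s : Fin S) (a : Fin A) :
    unitInterval :=
  if o = some (s, a) then p' else p

/-- The transition probabilities of the hard instances. -/
def hardP (p p' : unitInterval) (o : Option (Fin S × Fin A)) : Fin S → Fin A → PMF (Fin S) :=
  T.transition (hardStay p p' o)

section HardP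

variable {p p' : unitInterval}

theorem hardP_none_eq {s : Fin S} {a : Fin A} {q : Fin S × Fin A} (hq : q ≠ (s, a)) :
    T.hardP p p' none q.1 q.2 = T.hardP p p' (some (s, a)) q.1 q.2 := by
  have h : some (s, a) ≠ some (q.1, q.2) := fun h => hq (Option.some.inj h).symm
  simp only [hardP, transition, hardStay, if_neg h]
  rfl

variable {T} in
theorem IsLeaf.ne_sink {s : Fin S} (hs : T.IsLeaf s) : s ≠ T.sink := by
  intro h
  have h1 : 1 ≤ s.1 := Nat.one_le_two_pow.trans hs.1
  simp [h, sink] at h1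

theorem hardP_none_leaf {s : Fin S} (hs : T.IsLeaf s) (a : Fin A) :
    T.hardP p p' none s a = twoPointPMF s T.sink p := by
  simp [hardP, transition, hardStay, next, hs, hs.not_isInner]

theorem hardP_some_leaf {s : Fin S} (hs : T.IsLeaf s) (a : Fin A) :
    T.hardP p p' (some (s, a)) s a = twoPointPMF s T.sink p' := by
  simp [hardP, transition, hardStay, next, hs, hs.not_isInner]

variable (h0 : 0 < (p : ℝ)) (h1 : (p : ℝ) < 1) (h0' : 0 < (p' : ℝ)) (h1' : (p' : ℝ) < 1)

include h0 h1 h0' h1'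

theorem hardP_eq_zero_iff {s : Fin S} (hs : T.IsLeaf s) (a : Fin A) (s₁ : Fin S) (a₁ : Fin A)
    (s₂ : Fin S) :
    T.hardP p p' none s₁ a₁ s₂ = 0 ↔ T.hardP p p' (some (s, a)) s₁ a₁ s₂ = 0 := by
  by_cases hq : (s₁, a₁) = (s, a)
  · obtain ⟨rfl, rfl⟩ := Prod.mk.inj hq
    rw [T.hardP_none_leaf hs, T.hardP_some_leaf hs, twoPointPMF_eq_zero_iff _ _ h0 h1,
      twoPointPMF_eq_zero_iff _ _ h0' h1']
  · rw [T.hardP_none_eq hq]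

theorem sum_hardP_mul_log_le {s : Fin S} (hs : T.IsLeaf s) (a : Fin A) {k : ℝ}
    (hk : (p' - p : ℝ) ^ 2 / (p' * (1 - p')) ≤ k) (q : Fin S × Fin A) :
    ∑ s', (T.hardP p p' none q.1 q.2 s').toReal *
      Real.log ((T.hardP p p' none q.1 q.2 s').toReal /
        (T.hardP p p' (some (s, a)) q.1 q.2 s').toReal) ≤
      ({(s, a)} : Set (Fin S × Fin A)).indicator (fun _ => k) q := by
  by_cases hq : q = (s, a)
  · rw [hq, Set.indicator_of_mem (Set.mem_singleton _)]
    simp only [T.hardP_none_leaf hs, T.hardP_some_leaf hs]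
    exact (sum_twoPointPMF_mul_log_le hs.ne_sink h0 h1 h0' h1').trans hk
  · have hq' : q ∉ ({(s, a)} : Set (Fin S × Fin A)) := hq
    rw [Set.indicator_of_notMem hq', T.hardP_none_eq hq]
    refine (Finset.sum_eq_zero fun s' _ => ?_).le
    rcases eq_or_ne (T.hardP p p' (some (s, a)) q.1 q.2 s').toReal 0 with h | h
    · rw [h, zero_mul]
    · rw [div_self h, Real.log_one, mul_zero]

/-- If the instances with a distinguished pair have no solution in common with the instance without
one, then every sound algorithm has to sample all pairs of the latter often. -/
theorem le_expectedSamples {D : CMDPSpec (Fin S) (Fin A)} {ζ ε δ k : ℝ} (hδ : 0 < δ) (hk0 : 0 < k)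
    (hk : (p' - p : ℝ) ^ 2 / (p' * (1 - p')) ≤ k)
    (hnone : (CMDP.mk D (T.hardP p p' none)).IsSlaterConstant ζ)
    (hsome : ∀ s, T.IsLeaf s → ∀ a ≠ T.left,
      (CMDP.mk D (T.hardP p p' (some (s, a)))).IsSlaterConstant ζ ∧
      Disjoint ((CMDP.mk D (T.hardP p p' none)).strictlyGood ε)
        ((CMDP.mk D (T.hardP p p' (some (s, a)))).strictlyGood ε))
    (K : GenAlgorithm (Fin S) (Fin A)) (hK : K.IsSound D ζ ε δ) :
    ENNReal.ofReal (2 ^ T.depth * (A - 1) * (Real.log (1 / (4 * δ)) / k)) ≤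
      K.expectedSamples (T.hardP p p' none) := by
  classical
  rcases eq_or_ne (K.expectedSamples (T.hardP p p' none)) ∞ with hE | hE
  · exact hE ▸ le_top
  have hpair : ∀ s, T.IsLeaf s → ∀ a ≠ T.left, Real.log (1 / (4 * δ)) / k ≤
      (K.pairSamples (T.hardP p p' none) (s, a)).toReal := by
    intro s hs a ha
    rw [div_le_iff₀' hk0]
    exact K.log_le_mul_pairSamples (T.hardP_eq_zero_iff h0 h1 h0' h1' hs a) hk0.le
      (T.sum_hardP_mul_log_le h0 h1 h0' h1' hs a hk) (CMDP.measurableSet_strictlyGood _ _)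
      (CMDP.measurableSet_strictlyGood _ _) (hsome s hs a ha).2 hδ (hK _ hnone)
      (hK _ (hsome s hs a ha).1) hE
  have hcard : (((Finset.univ.erase T.left).card : ℕ) : ℝ) = A - 1 := by
    rw [Finset.card_erase_of_mem (Finset.mem_univ _), Finset.card_univ, Fintype.card_fin,
      Nat.cast_sub (one_le_two.trans T.two_le), Nat.cast_one]
  rw [ENNReal.ofReal_le_iff_le_toReal hE, K.expectedSamples_eq_sum,
    ENNReal.toReal_sum fun q _ => K.pairSamples_ne_top _ hE q]
  calc 2 ^ T.depth * (A - 1) * (Real.log (1 / (4 * δ)) / k)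
      = ∑ _q ∈ T.leaves ×ˢ Finset.univ.erase T.left, Real.log (1 / (4 * δ)) / k := by
        rw [Finset.sum_const, Finset.card_product, nsmul_eq_mul, Nat.cast_mul, T.card_leaves, hcard]
    _ ≤ ∑ q ∈ T.leaves ×ˢ Finset.univ.erase T.left,
          (K.pairSamples (T.hardP p p' none) q).toReal :=
        Finset.sum_le_sum fun q hq => hpair q.1 (T.mem_leaves.1 (Finset.mem_product.1 hq).1) q.2
          (Finset.ne_of_mem_erase (Finset.mem_product.1 hq).2)
    _ ≤ _ := Finset.sum_le_sum_of_subset_of_nonneg (Finset.subset_univ _)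
        fun q _ _ => ENNReal.toReal_nonneg

end HardP

section Value

variable {T} {D : CMDPSpec (Fin S) (Fin A)} {p p' : unitInterval} {u η : ℝ}
  (hρ : D.ρ = PMF.pure T.root) (hu : 0 < u) (hη1 : η < 1)
  (hp : D.γ * p = 1 - 2 * u) (hp' : D.γ * p' = 1 - 2 * u * (1 - η))
  (π : Policy (Fin S) (Fin A))

include hu hη1 hp hp'

theorem mul_hardStay_lt_one (o : Option (Fin S × Fin A)) (s : Fin S) (a : Fin A) :
    D.γ * hardStay p p' o s a < 1 := by
  unfold hardStay
  split_ifs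
  · rw [hp']
    nlinarith
  · rw [hp]
    linarith

include hρ

theorem value_none (x y : ℝ) : (CMDP.mk D (T.hardP p p' none)).value (T.leafReward x y) π =
    (x * D.γ ^ T.depth + (y - x) * T.riskMass D.γ π) / (2 * u) := by
  have h := value_leafReward (T := T) (M := CMDP.mk D (T.hardP p p' none)) rfl hρ π
    (mul_hardStay_lt_one hu hη1 hp hp' none) x y
  have h1 : ∀ s, 1 - D.γ * ∑ a, π s a * (hardStay p p' none s a : ℝ) = 2 * u := by
    intro s
    have h2 : ∑ a, π s a = 1 := (π s).2.2
    simp only [hardStay, reduceCtorEq, if_false, ← Finset.sum_mul, h2, one_mul, hp]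
    ring
  simp only [h1] at h
  rw [h, riskMass, ← T.sum_reach π, Finset.mul_sum, Finset.mul_sum, ← Finset.sum_add_distrib,
    Finset.sum_div]
  refine Finset.sum_congr rfl fun s _ => ?_
  rw [reach]
  ring

/-- Only the leaf `s` differs from the base instance: its denominator becomes `2u(1 - ηz)` with `z =
π s a`, and `1 / (1 - ηz) = 1 + ηz / (1 - ηz)` isolates the gain. -/
theorem value_some (hη : 0 ≤ η) {s : Fin S} (hs : T.IsLeaf s) (a : Fin A) (x y : ℝ) :
    (CMDP.mk D (T.hardP p p' (some (s, a)))).value (T.leafReward x y) π =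
    (x * D.γ ^ T.depth + (y - x) * T.riskMass D.γ π +
      T.reach D.γ π s * (x + (y - x) * (1 - π s T.left)) *
        (η * π s a / (1 - η * π s a))) / (2 * u) := by
  have h := value_leafReward (T := T) (M := CMDP.mk D (T.hardP p p' (some (s, a)))) rfl hρ π
    (mul_hardStay_lt_one hu hη1 hp hp' (some (s, a))) x y
  have hz : 0 < 1 - η * π s a := by
    linarith [mul_le_of_le_one_right hη (policy_le_one π s a)]
  have h1 : ∀ s', 1 - D.γ * ∑ b, π s' b * (hardStay p p' (some (s, a)) s' b : ℝ) =
      2 * u * (1 - if s' = s then η * π s a else 0) := by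
    intro s'
    have h2 : ∑ b, π s' b = 1 := (π s').2.2
    have h3 : ∀ b, D.γ * (π s' b * (hardStay p p' (some (s, a)) s' b : ℝ)) =
        π s' b * (1 - 2 * u) + if b = a then (if s' = s then 2 * u * (η * π s a) else 0) else 0 := by
      intro b
      by_cases hb : b = a
      · by_cases hs' : s' = s
        · rw [hb, hs', hardStay, if_pos rfl, mul_left_comm, hp']
          simp
          ring
        · rw [hardStay, if_neg (by simp [Ne.symm hs']), mul_left_comm, hp]
          simp [hs']
      · rw [hardStay, if_neg (by simp [Ne.symm hb]), mul_left_comm, hp]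
        simp [hb]
    rw [Finset.mul_sum, Finset.sum_congr rfl fun b _ => h3 b, Finset.sum_add_distrib,
      ← Finset.sum_mul, h2]
    simp only [Finset.sum_ite_eq', Finset.mem_univ, if_true]
    split_ifs <;> ring
  simp only [h1] at h
  have h4 : T.reach D.γ π s * (x + (y - x) * (1 - π s T.left)) *
      (η * π s a / (1 - η * π s a)) = ∑ s' ∈ T.leaves, if s' = s then
        T.reach D.γ π s * (x + (y - x) * (1 - π s T.left)) *
          (η * π s a / (1 - η * π s a)) else 0 := by
    rw [Finset.sum_ite_eq', if_pos (T.mem_leaves.2 hs)]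
  rw [h, riskMass, ← T.sum_reach π, Finset.mul_sum, Finset.mul_sum, h4, ← Finset.sum_add_distrib,
    ← Finset.sum_add_distrib, Finset.sum_div]
  refine Finset.sum_congr rfl fun s' _ => ?_
  by_cases hs' : s' = s
  · rw [if_pos hs', if_pos hs', hs', reach]
    field_simp
    ring
  · rw [if_neg hs', if_neg hs', reach]
    ring

end Value

end HeapTree

/-! ### Numerical inequalities behind the separation -/

theorem mul_div_one_sub_le {η z : ℝ} (hη0 : 0 ≤ η) (hη : η ≤ 1 / 4) (hz0 : 0 ≤ z) (hz1 : z ≤ 1) :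
    η * z / (1 - η * z) ≤ 4 / 3 * (η * z) := by
  have hηz : η * z ≤ 1 / 4 := (mul_le_of_le_one_right hη0 hz1).trans hη
  rw [div_le_iff₀ (by linarith)]
  nlinarith [mul_nonneg hη0 hz0]

/-- A boosted pair with mass at most half of the total gives too little reward if the safe action is
better than the other ones by the factor `1 + η / 2`. -/
theorem not_good_of_reward_gap {u ε g η W q w z : ℝ} (hu : 0 < u) (hε : 0 < ε) (hg : 1 / 2 ≤ g)
    (hη0 : 0 < η) (hη : η ≤ 1 / 4) (hεη : 24 * (u * ε) ≤ η) (hz : 0 ≤ z)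
    (hzw : z ≤ w) (hw : w ≤ 1) (hq : 0 ≤ q) (hqW : q * w ≤ W)
    (h1 : η / 2 * W ≤ 2 * (u * ε))
    (h2 : g * (1 - η / 2) + g * (1 - η / 2) * (η / (1 - η)) -
      (g - η / 2 * W + q * (1 - η / 2 * w) * (η * z / (1 - η * z))) ≤ 2 * (u * ε)) : False := by
  have e1 : 0 < 1 - η := by linarith
  have hηz : η * z ≤ 1 / 4 := by nlinarith
  have e2 : 0 < 1 - η * z := by linarith
  have k1 : η ≤ (1 - η / 2) * (η / (1 - η)) := by
    rw [← mul_div_assoc, le_div_iff₀ e1]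
    nlinarith
  have k2 := mul_div_one_sub_le hη0.le hη hz (hzw.trans hw)
  have k3 : q * (1 - η / 2 * w) * (η * z / (1 - η * z)) ≤ 4 / 3 * η * W := by
    have hwn : 0 ≤ w := hz.trans hzw
    have a1 : q * (1 - η / 2 * w) ≤ q := mul_le_of_le_one_right hq (by nlinarith)
    have a2 : 0 ≤ η * z / (1 - η * z) := div_nonneg (mul_nonneg hη0.le hz) e2.le
    calc _ ≤ q * (4 / 3 * (η * z)) := mul_le_mul a1 k2 a2 hq
      _ = 4 / 3 * η * (q * z) := by ring
      _ ≤ 4 / 3 * η * W := by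
        refine mul_le_mul_of_nonneg_left ?_ (by positivity)
        exact (mul_le_mul_of_nonneg_left hzw hq).trans hqW
  have k4 : g * (η / 2) ≤ g * (-(η / 2) + (1 - η / 2) * (η / (1 - η))) := by
    refine mul_le_mul_of_nonneg_left ?_ (by linarith)
    linarith
  -- The target gains at least `gη / 2 ≥ 6uε`. The net gain of the other policy is at most `(4/3 -
  -- 1/2)ηW ≤ (10/3)uε`. The difference exceeds `2uε`.
  have hpos := mul_pos hu hε
  nlinarith

/-- With `η ≤ χ` the boost never repays the constraint reward lost by deviating from `left`, so the
Slater constant is the same in all instances. -/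
theorem boost_le {χ η q w z W : ℝ} (hη0 : 0 ≤ η) (hη : η ≤ 1 / 4) (hηχ : η ≤ χ) (hz : 0 ≤ z)
    (hzw : z ≤ w) (hw : w ≤ 1) (hq : 0 ≤ q) (hqW : q * w ≤ W) :
    q * (1 - χ * w) * (η * z / (1 - η * z)) ≤ χ * W := by
  have e2 : 0 < 1 - η * z := by nlinarith
  have k : (1 - χ * w) * (η * z / (1 - η * z)) ≤ χ * w := by
    rw [← mul_div_assoc, div_le_iff₀ e2]
    nlinarith [mul_le_mul hηχ hzw hz (hη0.trans hηχ)]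
  calc _ = q * ((1 - χ * w) * (η * z / (1 - η * z))) := by ring
    _ ≤ q * (χ * w) := mul_le_mul_of_nonneg_left k hq
    _ = χ * (q * w) := by ring
    _ ≤ χ * W := mul_le_mul_of_nonneg_left hqW (hη0.trans hηχ)

/-- Going from weight `1/2` to `w` costs `η / 4` of constraint reward, and the boost returns at
least that. After clearing the denominator the claim reduces to `w(1 - χ/2) ≥ 1/4`. -/
theorem target_feasible {χ η : ℝ} (hη0 : 0 < η) (hη : η ≤ 1 / 4) (hηχ : η ≤ χ) (hχ1 : χ ≤ 1)
    {w : ℝ} (hw : w = 1 / 2 + η / (4 * χ)) :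
    -(χ / 2) ≤ -(χ * w) + (1 - χ * w) * (η * w / (1 - η * w)) := by
  have hχ : 0 < χ := hη0.trans_le hηχ
  have h1 : χ * w = χ / 2 + η / 4 := by
    rw [hw]
    field_simp
  have h2 : w ≤ 1 := by
    have : η / (4 * χ) ≤ 1 / 4 := by
      rw [div_le_div_iff₀ (by positivity) (by norm_num)]
      linarith
    linarith
  have h3 : 1 / 2 ≤ w := by
    have : 0 < η / (4 * χ) := by positivity
    linarith
  have e : 0 < 1 - η * w := by nlinarith
  have h4 : χ * w - χ / 2 ≤ (1 - χ * w) * (η * w / (1 - η * w)) := by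
    rw [← mul_div_assoc, le_div_iff₀ e, h1]
    have h5 : 0 ≤ w * (1 - χ / 2) - 1 / 4 := by nlinarith
    nlinarith [mul_nonneg hη0.le h5]
  linarith

/-- If the constraint binds, then the policy that uses the boosted pair as much as possible gains
more than `ε` over the policies that are feasible without the boost. -/
theorem target_reward_gap {u ε ζ g η χ w W Q z : ℝ} (hu : 0 < u) (hζ : 0 < ζ) (hε : 0 < ε)
    (hg : 1 / 2 ≤ g) (hg1 : g ≤ 1) (hη : η ≤ 1 / 4) (hζu : ζ * u ≤ 3 / 160)
    (hηdef : η = 1280 * ε * ζ * u ^ 2) (hχ : χ = 4 * u * ζ / g) (hw : w = 1 / 2 + η / (4 * χ))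
    (hw1 : w ≤ 1) (hW : χ * W ≤ 2 * u * ζ) (hQ0 : 0 ≤ Q) (hQ : Q ≤ W) (hz0 : 0 ≤ z)
    (hz1 : z ≤ 1) :
    ε * (2 * u) < w * g + g * w * (η * w / (1 - η * w)) - (W + Q * (η * z / (1 - η * z))) := by
  have hεu := mul_pos hε hu
  have hη0 : 0 < η := by rw [hηdef]; positivity
  have hg0 : 0 < g := by linarith
  have hχ0 : 0 < χ := by rw [hχ]; positivity
  have hw0 : 0 < w := by rw [hw]; positivity
  have hWg : W ≤ g / 2 := by
    refine le_of_mul_le_mul_left (hW.trans_eq ?_) hχ0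
    rw [hχ]
    field_simp
    norm_num
  have k1 : 0 ≤ g * w * (η * w / (1 - η * w)) := by
    have : η * w ≤ η := mul_le_of_le_one_right hη0.le hw1
    have : 0 ≤ 1 - η * w := by linarith
    positivity
  have k2 : Q * (η * z / (1 - η * z)) ≤ 2 / 3 * η := by
    have h1 : η * z / (1 - η * z) ≤ 4 / 3 * η :=
      (mul_div_one_sub_le hη0.le hη hz0 hz1).trans
        (mul_le_mul_of_nonneg_left (mul_le_of_le_one_right hη0.le hz1) (by norm_num))
    calc _ ≤ Q * (4 / 3 * η) := mul_le_mul_of_nonneg_left h1 hQ0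
      _ ≤ 1 / 2 * (4 / 3 * η) := mul_le_mul_of_nonneg_right (by linarith) (by positivity)
      _ = _ := by ring
  -- The extra weight earns `20εu`, while the boost is worth at most `16εu` to the competitor
  -- (`k5`); the remaining `4εu` beats `2εu`.
  have k4 : 20 * (ε * u) ≤ η / (4 * χ) * g := by
    have h : η / (4 * χ) * g = 80 * (ε * u) * g ^ 2 := by
      rw [hηdef, hχ]
      field_simp
      norm_num
    have h1 : (1 / 2) ^ 2 ≤ g ^ 2 := pow_le_pow_left₀ (by norm_num) hg 2
    rw [h]
    linarith [mul_le_mul_of_nonneg_left h1 (by positivity : 0 ≤ 80 * (ε * u))]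
  have k5 : 2 / 3 * η ≤ 16 * (ε * u) := by
    have h : 2 / 3 * η = 2560 / 3 * (ε * u) * (ζ * u) := by
      rw [hηdef]
      ring
    rw [h]
    linarith [mul_le_mul_of_nonneg_left hζu (by positivity : 0 ≤ 2560 / 3 * (ε * u))]
  have k6 : w * g = g / 2 + η / (4 * χ) * g := by
    rw [hw]
    ring
  linarith

namespace CMDP

variable {S A : Type} [Fintype S] [Fintype A]

theorem disjoint_strictlyGood {M M' : CMDP S A} {ε : ℝ}
    (h : ∀ π, M.Feasible π → (∀ π', M.Feasible π' → M.value M.r π' - M.value M.r π ≤ ε) →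
      ∃ π', M'.Feasible π' ∧ ε < M'.value M'.r π' - M'.value M'.r π) :
    Disjoint (M.strictlyGood ε) (M'.strictlyGood ε) := by
  refine Set.disjoint_left.2 fun π hπ hπ' => ?_
  obtain ⟨π', h1, h2⟩ := h π hπ.2 hπ.1
  exact (hπ'.1 π' h1).not_gt h2

end CMDP

/-! ### Known data with a vacuous or a binding constraint -/

namespace HeapTree

variable {S A : ℕ} (T : HeapTree S A)

/-- The known data of the hard instances: rewards `rx`, `cx` for the safe action and `ry`, `cy` for
the other actions at the leaves. -/
def hardSpec {γ rx ry cx cy : ℝ} (hγ : γ ∈ Set.Ico (0 : ℝ) 1) (hrx : rx ∈ Set.Icc (0 : ℝ) 1)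
    (hry : ry ∈ Set.Icc (0 : ℝ) 1) (hcx : cx ∈ Set.Icc (0 : ℝ) 1) (hcy : cy ∈ Set.Icc (0 : ℝ) 1)
    (b : ℝ) : CMDPSpec (Fin S) (Fin A) where
  r := T.leafReward rx ry
  c := T.leafReward cx cy
  b := b
  ρ := PMF.pure T.root
  γ := γ
  r_mem := T.leafReward_mem hrx hry
  c_mem := T.leafReward_mem hcx hcy
  γ_mem := hγ

/-- `D` is known data for which the instances with a distinguished pair have the Slater constant of
the instance without one, but no solution in common with it. -/
def IsHard (p p' : unitInterval) (ζ ε : ℝ) (D : CMDPSpec (Fin S) (Fin A)) : Prop :=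
  (CMDP.mk D (T.hardP p p' none)).IsSlaterConstant ζ ∧
    ∀ s, T.IsLeaf s → ∀ a ≠ T.left,
      (CMDP.mk D (T.hardP p p' (some (s, a)))).IsSlaterConstant ζ ∧
      Disjoint ((CMDP.mk D (T.hardP p p' none)).strictlyGood ε)
        ((CMDP.mk D (T.hardP p p' (some (s, a)))).strictlyGood ε)

variable {γ u ζ ε η : ℝ} {p p' : unitInterval}

theorem exists_isHard_of_large (hγ : γ ∈ Set.Ico (0 : ℝ) 1) (hu : 0 < u) (hζ : 0 < ζ) (hε : 0 < ε)
    (hg : 1 / 2 ≤ γ ^ T.depth) (hη0 : 0 < η) (hη : η ≤ 1 / 4) (hεη : 24 * (u * ε) ≤ η)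
    (hp : γ * p = 1 - 2 * u) (hp' : γ * p' = 1 - 2 * u * (1 - η)) :
    ∃ D : CMDPSpec (Fin S) (Fin A), D.γ = γ ∧ T.IsHard p p' ζ ε D := by
  have h01 : (0 : ℝ) ∈ Set.Icc (0 : ℝ) 1 := ⟨le_rfl, zero_le_one⟩
  have h11 : (1 : ℝ) ∈ Set.Icc (0 : ℝ) 1 := ⟨zero_le_one, le_rfl⟩
  have hr : 1 - η / 2 ∈ Set.Icc (0 : ℝ) 1 := ⟨by linarith, by linarith⟩
  have hη1 : η < 1 := by linarith
  -- The constraint value is identically `0`, so every policy is feasible and the Slater constant is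
  -- `ζ`. The gap `η / 2` is smaller than the boost, so the boosted pair overtakes `left`.
  let D := T.hardSpec hγ h11 hr h01 h01 (-ζ)
  have vnone : ∀ π, (CMDP.mk D (T.hardP p p' none)).value D.r π =
      (1 * γ ^ T.depth + (1 - η / 2 - 1) * T.riskMass γ π) / (2 * u) :=
    fun π => value_none (D := D) rfl hu hη1 hp hp' π _ _
  have vsome : ∀ s, T.IsLeaf s → ∀ a π,
      (CMDP.mk D (T.hardP p p' (some (s, a)))).value D.r π =
      (1 * γ ^ T.depth + (1 - η / 2 - 1) * T.riskMass γ π +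
        T.reach γ π s * (1 + (1 - η / 2 - 1) * (1 - π s T.left)) *
        (η * π s a / (1 - η * π s a))) / (2 * u) :=
    fun s hs a π => value_some (D := D) rfl hu hη1 hp hp' π hη0.le hs a _ _
  have vc : ∀ o π, (CMDP.mk D (T.hardP p p' o)).value D.c π = 0 := by
    intro o π
    have h0 : D.c = fun _ _ => 0 := by
      funext s a
      simp [D, hardSpec, leafReward]
    simp [h0, CMDP.value]
  have hslater : ∀ o, (CMDP.mk D (T.hardP p p' o)).IsSlaterConstant ζ := by
    intro o
    have h : ∀ π, (CMDP.mk D (T.hardP p p' o)).value D.c π - D.b = ζ := fun π => by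
      rw [vc]
      exact (zero_sub _).trans (neg_neg ζ)
    obtain ⟨π, -⟩ := T.exists_policy_safe γ
    exact ⟨⟨π, h π⟩, by rintro _ ⟨π, rfl⟩; exact (h π).le⟩
  have hfeas : ∀ o π, (CMDP.mk D (T.hardP p p' o)).Feasible π := fun o π =>
    (neg_nonpos.2 hζ.le).trans_eq (vc o π).symm
  refine ⟨D, rfl, hslater none, fun s hs a ha => ⟨hslater _, ?_⟩⟩
  refine CMDP.disjoint_strictlyGood fun π _ hopt => ?_
  obtain ⟨π₀, hπ₀, -⟩ := T.exists_policy_safe γ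
  obtain ⟨π₁, h1, h2, h3, h4⟩ := T.exists_policy_target γ hs ha 1
  have k0 := hopt π₀ (hfeas _ _)
  refine ⟨π₁, hfeas _ _, ?_⟩
  by_contra! k1
  have v0 := vnone π₀
  have v1 := vnone π
  have v2 := vsome s hs a π₁
  have v3 := vsome s hs a π
  simp only [hπ₀, h1, h2, h3, h4] at v0 v2
  have k0' : (CMDP.mk D (T.hardP p p' none)).value D.r π₀ -
      (CMDP.mk D (T.hardP p p' none)).value D.r π ≤ ε := k0
  have k1' : (CMDP.mk D (T.hardP p p' (some (s, a)))).value D.r π₁ -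
      (CMDP.mk D (T.hardP p p' (some (s, a)))).value D.r π ≤ ε := k1
  rw [v0, v1, ← sub_div, div_le_iff₀ (by positivity)] at k0'
  rw [v2, v3, ← sub_div, div_le_iff₀ (by positivity)] at k1'
  simp only [Set.Icc.coe_one] at k1'
  refine not_good_of_reward_gap hu hε hg hη0 hη hεη (policy_nonneg π s a) (T.policy_le_one_sub π s ha)
    (sub_le_self _ (policy_nonneg π s _)) (T.reach_nonneg hγ.1 π s) (T.reach_mul_le_riskMass hγ.1 π hs)
    (by linarith) (le_of_eq_of_le ?_ (k1'.trans_eq (by ring)))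
  simp only [mul_one, one_mul, sub_self, sub_zero]
  ring

theorem exists_isHard_of_small (hγ : γ ∈ Set.Ico (0 : ℝ) 1) (hu : 0 < u) (hζ : 0 < ζ) (hε : 0 < ε)
    (hg : 1 / 2 ≤ γ ^ T.depth) (hη : η ≤ 1 / 4) (hζu : ζ * u ≤ 3 / 160) (hεu : ε * u ≤ 1 / 1280)
    (hηdef : η = 1280 * ε * ζ * u ^ 2)
    (hp : γ * p = 1 - 2 * u) (hp' : γ * p' = 1 - 2 * u * (1 - η)) :
    ∃ D : CMDPSpec (Fin S) (Fin A), D.γ = γ ∧ T.IsHard p p' ζ ε D := by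
  have hη0 : 0 < η := by rw [hηdef]; positivity
  have hη1 : η < 1 := by linarith
  set g := γ ^ T.depth
  have hg1 : g ≤ 1 := pow_le_one₀ hγ.1 hγ.2.le
  have hg0 : 0 < g := by linarith
  obtain ⟨χ, hχ⟩ : ∃ χ, χ = 4 * u * ζ / g := ⟨_, rfl⟩
  have hχg : χ * g = 4 * u * ζ := by rw [hχ]; field_simp
  have hχ0 : 0 < χ := by rw [hχ]; positivity
  have hχ1 : χ ≤ 1 := by
    rw [hχ, div_le_one hg0]
    linarith
  have hηχ : η ≤ χ := by
    have h1 : η ≤ 4 * u * ζ := by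
      rw [hηdef]
      nlinarith [mul_pos hu hζ]
    have h2 : χ * g ≤ χ := mul_le_of_le_one_right hχ0.le hg1
    linarith
  have h01 : (0 : ℝ) ∈ Set.Icc (0 : ℝ) 1 := ⟨le_rfl, zero_le_one⟩
  have h11 : (1 : ℝ) ∈ Set.Icc (0 : ℝ) 1 := ⟨zero_le_one, le_rfl⟩
  have hc : 1 - χ ∈ Set.Icc (0 : ℝ) 1 := ⟨by linarith, by linarith⟩
  -- The safe policy has constraint value `g / (2u)`, hence slack `ζ`. By the choice of `χ`, the
  -- base instance allows risk mass exactly up to `g / 2`.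
  let D := T.hardSpec hγ h01 h11 h11 hc (g / (2 * u) - ζ)
  have hb : D.b = g / (2 * u) - ζ := rfl
  have vnone : ∀ π, (CMDP.mk D (T.hardP p p' none)).value D.c π =
      (1 * g + (1 - χ - 1) * T.riskMass γ π) / (2 * u) :=
    fun π => value_none (D := D) rfl hu hη1 hp hp' π _ _
  have vsome : ∀ s, T.IsLeaf s → ∀ a π,
      (CMDP.mk D (T.hardP p p' (some (s, a)))).value D.c π =
      (1 * g + (1 - χ - 1) * T.riskMass γ π +
        T.reach γ π s * (1 + (1 - χ - 1) * (1 - π s T.left)) *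
        (η * π s a / (1 - η * π s a))) / (2 * u) :=
    fun s hs a π => value_some (D := D) rfl hu hη1 hp hp' π hη0.le hs a _ _
  have rsome : ∀ s, T.IsLeaf s → ∀ a π,
      (CMDP.mk D (T.hardP p p' (some (s, a)))).value D.r π =
      (0 * g + (1 - 0) * T.riskMass γ π +
        T.reach γ π s * (0 + (1 - 0) * (1 - π s T.left)) *
        (η * π s a / (1 - η * π s a))) / (2 * u) :=
    fun s hs a π => value_some (D := D) rfl hu hη1 hp hp' π hη0.le hs a _ _
  obtain ⟨π₀, hπ₀, hπ₀'⟩ := T.exists_policy_safe γ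
  have slater_none : (CMDP.mk D (T.hardP p p' none)).IsSlaterConstant ζ := by
    constructor
    · refine ⟨π₀, ?_⟩
      simp only [vnone, hπ₀, hb]
      ring
    · rintro _ ⟨π, rfl⟩
      simp only [vnone, hb]
      have h := T.riskMass_nonneg hγ.1 π
      rw [tsub_le_iff_right, add_sub_cancel]
      refine div_le_div_of_nonneg_right ?_ (by positivity)
      nlinarith
  have slater_some : ∀ s, T.IsLeaf s → ∀ a ≠ T.left,
      (CMDP.mk D (T.hardP p p' (some (s, a)))).IsSlaterConstant ζ := by
    intro s hs a ha
    constructor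
    · refine ⟨π₀, ?_⟩
      simp only [vsome s hs, hπ₀, hπ₀' s a ha, hb]
      ring
    · rintro _ ⟨π, rfl⟩
      simp only [vsome s hs, hb]
      have h := boost_le hη0.le hη hηχ (policy_nonneg π s a) (T.policy_le_one_sub π s ha)
        (sub_le_self _ (policy_nonneg π s _)) (T.reach_nonneg hγ.1 π s) (T.reach_mul_le_riskMass hγ.1 π hs)
      rw [tsub_le_iff_right, add_sub_cancel]
      refine div_le_div_of_nonneg_right ?_ (by positivity)
      have e : (1 + (1 - χ - 1) * (1 - π s T.left)) = 1 - χ * (1 - π s T.left) := by ring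
      rw [e]
      linarith
  refine ⟨D, rfl, slater_none, fun s hs a ha => ⟨slater_some s hs a ha, ?_⟩⟩
  -- Near-optimality in the base instance plays no role here: feasibility there already caps the
  -- risk mass.
  refine CMDP.disjoint_strictlyGood fun π hfeas _ => ?_
  obtain ⟨w, hw⟩ : ∃ w, w = 1 / 2 + η / (4 * χ) := ⟨_, rfl⟩
  have hηχ4 : η / (4 * χ) ≤ 1 / 4 := by
    rw [div_le_div_iff₀ (by positivity) (by norm_num)]
    linarith
  have hηχ0 : 0 < η / (4 * χ) := by positivity
  obtain ⟨π₁, h1, h2, h3, h4⟩ := T.exists_policy_target γ hs ha ⟨w, by linarith, by linarith⟩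
  have hW : χ * T.riskMass γ π ≤ 2 * u * ζ := by
    have h : D.b ≤ (CMDP.mk D (T.hardP p p' none)).value D.c π := hfeas
    rw [hb, vnone, tsub_le_iff_right, div_add' _ _ _ (by positivity),
      div_le_div_iff_of_pos_right (by positivity)] at h
    linarith
  refine ⟨π₁, ?_, ?_⟩
  · have v := vsome s hs a π₁
    rw [h1, h2, h3, h4] at v
    have h := mul_le_mul_of_nonneg_left (target_feasible hη0 hη hηχ hχ1 hw) hg0.le
    change D.b ≤ (CMDP.mk D (T.hardP p p' (some (s, a)))).value D.c π₁
    rw [v, hb, tsub_le_iff_right, div_add' _ _ _ (by positivity),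
      div_le_div_iff_of_pos_right (by positivity)]
    simp only
    have e : (1 + (1 - χ - 1) * (1 - (1 - w))) = 1 - χ * w := by ring
    rw [e, mul_assoc g]
    linarith
  · change ε < (CMDP.mk D (T.hardP p p' (some (s, a)))).value D.r π₁ -
      (CMDP.mk D (T.hardP p p' (some (s, a)))).value D.r π
    have v := rsome s hs a π₁
    rw [h1, h2, h3, h4] at v
    rw [v, rsome s hs, ← sub_div, lt_div_iff₀ (by positivity)]
    have h := target_reward_gap hu hζ hε hg hg1 hη hζu hηdef hχ hw (by linarith) hW
      (mul_nonneg (T.reach_nonneg hγ.1 π s) (sub_nonneg.2 (policy_le_one π s T.left)))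
      (T.reach_mul_le_riskMass hγ.1 π hs) (policy_nonneg π s a) (policy_le_one π s a)
    simp only [zero_mul, zero_add, sub_zero, one_mul, sub_sub_cancel]
    exact h

end HeapTree

/-! ### Choice of the parameters -/

namespace HeapTree

/-- A complete binary tree of nearly full size in `Fin S`. -/
def ofSize {S A : ℕ} (hS : 2 ≤ S) (hA : 2 ≤ A) : HeapTree S A where
  depth := Nat.log 2 S - 1
  size_le := by
    rw [Nat.sub_add_cancel (Nat.log_pos one_lt_two hS)]
    exact Nat.pow_log_le_self 2 (by omega)
  two_le := hA

theorem le_four_mul_pow_depth {S A : ℕ} (hS : 2 ≤ S) (hA : 2 ≤ A) :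
    (S : ℝ) ≤ 4 * 2 ^ (ofSize hS hA).depth := by
  have h : S < 2 ^ (Nat.log 2 S + 1) := Nat.lt_pow_succ_log_self one_lt_two S
  have h1 : Nat.log 2 S + 1 = (Nat.log 2 S - 1) + 2 := by
    have := Nat.log_pos one_lt_two hS
    omega
  rw [h1, pow_add] at h
  have h2 : (S : ℝ) < 2 ^ (Nat.log 2 S - 1) * 2 ^ 2 := by exact_mod_cast h
  change (S : ℝ) ≤ 4 * 2 ^ (Nat.log 2 S - 1)
  linarith

/-- Bernoulli's inequality with depth at most `2 log S`. This is what ties the range of `γ` to `1 /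
log S`. -/
theorem half_le_pow_depth {S A : ℕ} (T : HeapTree S A) {γ : ℝ} (hγ : 0 ≤ γ)
    (h : (1 - γ) * Real.log S ≤ 1 / 4) : 1 / 2 ≤ γ ^ T.depth := by
  have hb := one_add_mul_le_pow (a := γ - 1) (by linarith) T.depth
  rw [add_sub_cancel] at hb
  have h2 : (2 : ℝ) ^ T.depth ≤ S := by
    exact_mod_cast (Nat.pow_le_pow_right two_pos (Nat.le_succ _)).trans T.size_le
  have h3 : T.depth * Real.log 2 ≤ Real.log S := by
    rw [← Real.log_pow]
    exact Real.log_le_log (by positivity) h2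
  have h4 := Real.log_two_gt_d9
  rcases le_or_gt γ 1 with h1 | h1
  · have h5 : (T.depth : ℝ) * (1 / 2) ≤ Real.log S := by
      refine le_trans ?_ h3
      exact mul_le_mul_of_nonneg_left (by linarith) (Nat.cast_nonneg _)
    nlinarith [mul_le_mul_of_nonneg_left h5 (sub_nonneg.2 h1)]
  · linarith [one_le_pow₀ h1.le (n := T.depth)]

/-- The probabilities to stay at a leaf in the hard instances. -/
theorem exists_stay {γ u η : ℝ} (hγu : u = 1 - γ) (hu : 0 < u) (hu4 : u ≤ 1 / 4) (hη0 : 0 < η)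
    (hη : η ≤ 1 / 4) : ∃ p p' : unitInterval, (0 < (p : ℝ) ∧ (p : ℝ) < 1) ∧
      (0 < (p' : ℝ) ∧ (p' : ℝ) < 1) ∧ γ * p = 1 - 2 * u ∧ γ * p' = 1 - 2 * u * (1 - η) ∧
      (p' - p : ℝ) ^ 2 / (p' * (1 - p')) ≤ 16 * u * η ^ 2 := by
  have hγ : 0 < γ := by linarith
  have huη : 0 < u * η := mul_pos hu hη0
  have huη' : u * η ≤ u * (1 / 4) := mul_le_mul_of_nonneg_left hη hu.le
  have b1 : 0 < (1 - 2 * u) / γ := div_pos (by linarith) hγ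
  have b2 : (1 - 2 * u) / γ < 1 := by rw [div_lt_one hγ]; linarith
  have b3 : 0 < (1 - 2 * u * (1 - η)) / γ := div_pos (by linarith) hγ
  have b4 : (1 - 2 * u * (1 - η)) / γ < 1 := by rw [div_lt_one hγ]; linarith
  refine ⟨⟨_, b1.le, b2.le⟩, ⟨_, b3.le, b4.le⟩, ⟨b1, b2⟩, ⟨b3, b4⟩, mul_div_cancel₀ _ hγ.ne',
    mul_div_cancel₀ _ hγ.ne', ?_⟩
  simp only
  have e1 : (1 - 2 * u * (1 - η)) / γ - (1 - 2 * u) / γ = 2 * (u * η) / γ := by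
    rw [← sub_div]
    ring
  have e2 : 1 - (1 - 2 * u * (1 - η)) / γ = u * (1 - 2 * η) / γ := by
    rw [eq_div_iff hγ.ne', sub_mul, div_mul_cancel₀ _ hγ.ne', hγu]
    ring
  have h1 : 0 < 1 - 2 * u * (1 - η) := by linarith
  have h2 : 0 < 1 - 2 * η := by linarith
  have e3 : (2 * (u * η) / γ) ^ 2 / ((1 - 2 * u * (1 - η)) / γ * (u * (1 - 2 * η) / γ)) =
      4 * u * η ^ 2 / ((1 - 2 * u * (1 - η)) * (1 - 2 * η)) := by
    field_simp
    norm_num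
  rw [e1, e2, e3, div_le_iff₀ (mul_pos h1 h2)]
  have h3 : 1 / 2 * (1 / 2) ≤ (1 - 2 * u * (1 - η)) * (1 - 2 * η) :=
    mul_le_mul (by linarith) (by linarith) (by norm_num) h1.le
  have h4 : 0 ≤ 16 * u * η ^ 2 := by positivity
  linarith [mul_le_mul_of_nonneg_left h3 h4]

end HeapTree

end LowerBound

end

open LowerBound in
theorem LowerBound.exists_hard_spec {S A : ℕ} (hS : 2 ≤ S) (hA : 2 ≤ A) {γ ζ ε δ : ℝ}
    (hγ1 : γ < 1) (hγ : (1 - γ) * Real.log S ≤ 1 / 10000) (hζ : 0 < ζ) (hζu : ζ * (1 - γ) ≤ 1)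
    (hε : 0 < ε) (hεu : ε * (1 - γ) ≤ 1 / 10000) (hδ : 0 < δ) (hδ1 : δ < 1 / 4) :
    ∃ D : CMDPSpec (Fin S) (Fin A), D.γ = γ ∧
      ∀ K : GenAlgorithm (Fin S) (Fin A), K.IsSound D ζ ε δ →
        ∃ P : Fin S → Fin A → PMF (Fin S), (CMDP.mk D P).IsSlaterConstant ζ ∧
          ENNReal.ofReal (1 / (128 * 1280 ^ 2) *
            (S * A * Real.log (1 / (4 * δ)) / (ε ^ 2 * ζ ^ 2 * (1 - γ) ^ 5))) ≤
          K.expectedSamples P := by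
  obtain ⟨u, hu⟩ : ∃ u, u = 1 - γ := ⟨_, rfl⟩
  rw [← hu] at hγ hζu hεu ⊢
  have hu0 : 0 < u := by linarith
  have hlog : 1 / 2 ≤ Real.log S := by
    have h1 : (2 : ℝ) ≤ S := by exact_mod_cast hS
    linarith [Real.log_le_log two_pos h1, Real.log_two_gt_d9]
  have hu4 : u ≤ 1 / 4 := by nlinarith
  obtain ⟨η, hη⟩ : ∃ η, η = 1280 * ε * ζ * u ^ 2 := ⟨_, rfl⟩
  have hη0 : 0 < η := by rw [hη]; positivity
  have hη' : η = 1280 * (ε * u) * (ζ * u) := by rw [hη]; ring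
  have hη4 : η ≤ 1 / 4 := by
    rw [hη']
    have : ε * u * (ζ * u) ≤ 1 / 10000 * 1 := mul_le_mul hεu hζu (by positivity) (by norm_num)
    linarith
  obtain ⟨p, p', hp, hp', hγp, hγp', hk⟩ := HeapTree.exists_stay hu hu0 hu4 hη0 hη4
  have hγI : γ ∈ Set.Ico (0 : ℝ) 1 := ⟨by linarith, hγ1⟩
  let T : HeapTree S A := HeapTree.ofSize hS hA
  have hg : 1 / 2 ≤ γ ^ T.depth := T.half_le_pow_depth hγI.1 (by rw [← hu]; linarith)
  obtain ⟨D, hD, hhard⟩ : ∃ D : CMDPSpec (Fin S) (Fin A), D.γ = γ ∧ T.IsHard p p' ζ ε D := by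
    -- At `3 / 160` both regimes work: `η = 1280(εu)(ζu)` is at least `24εu` above it, and `(2/3)η ≤
    -- 16εu` below it.
    rcases le_total (ζ * u) (3 / 160) with h | h
    · exact T.exists_isHard_of_small hγI hu0 hζ hε hg hη4 h (by linarith) hη hγp hγp'
    · refine T.exists_isHard_of_large hγI hu0 hζ hε hg hη0 hη4 ?_ hγp hγp'
      rw [hη']
      have := mul_le_mul_of_nonneg_left h (mul_pos hε hu0).le
      linarith
  refine ⟨D, hD, fun K hK => ⟨_, hhard.1, ?_⟩⟩
  refine le_trans (ENNReal.ofReal_le_ofReal ?_) (T.le_expectedSamples hp.1 hp.2 hp'.1 hp'.2 hδ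
    (by positivity) hk hhard.1 hhard.2 K hK)
  have hl : 0 ≤ Real.log (1 / (4 * δ)) := by
    refine Real.log_nonneg ?_
    rw [le_div_iff₀ (by positivity)]
    linarith
  have hA' : (2 : ℝ) ≤ A := by exact_mod_cast hA
  have hSA : (S : ℝ) * A ≤ 8 * (2 ^ T.depth * (A - 1)) := by
    have h1 : (S : ℝ) * A ≤ (4 * 2 ^ T.depth) * (2 * (A - 1)) :=
      mul_le_mul (HeapTree.le_four_mul_pow_depth hS hA) (by linarith) (by positivity)
        (by positivity)
    linarith
  have e : Real.log (1 / (4 * δ)) / (16 * u * η ^ 2) =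
      1 / (16 * 1280 ^ 2) * (Real.log (1 / (4 * δ)) / (ε ^ 2 * ζ ^ 2 * u ^ 5)) := by
    rw [hη]
    field_simp
  have hx : 0 ≤ Real.log (1 / (4 * δ)) / (ε ^ 2 * ζ ^ 2 * u ^ 5) := by positivity
  rw [e, mul_div_assoc]
  linarith [mul_le_mul_of_nonneg_right hSA hx]

theorem mainTheorem2 :
    ∃ (C κ δ₀ : ℝ) (γ₀ : ℕ → ℝ) (ε₀ : ℝ → ℝ → ℝ),
      0 < C ∧ 0 < κ ∧ δ₀ ∈ Set.Ioo (0 : ℝ) 1 ∧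
      (∀ S : ℕ, 2 ≤ S →
        1 - 1 / Real.log S < γ₀ S ∧ γ₀ S ≤ 1 - κ / Real.log S) ∧
      (∀ γ ∈ Set.Ioo (0 : ℝ) 1, ∀ ζ ∈ Set.Ioc (0 : ℝ) (1 / (1 - γ)),
        κ * (1 / (1 - γ) * min 1 (γ / ((1 - γ) * ζ))) ≤ ε₀ γ ζ ∧
        ε₀ γ ζ ≤ 1 / (1 - γ) * min 1 (γ / ((1 - γ) * ζ))) ∧
      ∀ S A : ℕ, 2 ≤ S → 2 ≤ A →
      ∀ γ ∈ Set.Ioo (γ₀ S) 1, ∀ ζ ∈ Set.Ioc (0 : ℝ) (1 / (1 - γ)),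
      ∀ ε ∈ Set.Ioo 0 (ε₀ γ ζ), ∀ δ ∈ Set.Ioo 0 δ₀,
      ∃ D : LowerBound.CMDPSpec (Fin S) (Fin A), D.γ = γ ∧
        ∀ K : LowerBound.GenAlgorithm (Fin S) (Fin A), K.IsSound D ζ ε δ →
          ∃ P : Fin S → Fin A → PMF (Fin S),
            (LowerBound.CMDP.mk D P).IsSlaterConstant ζ ∧
            ENNReal.ofReal
              (C * (S * A * Real.log (1 / (4 * δ)) / (ε ^ 2 * ζ ^ 2 * (1 - γ) ^ 5)))
              ≤ K.expectedSamples P := by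
  have hlog : ∀ S : ℕ, 2 ≤ S → 0 < Real.log S := fun S hS =>
    Real.log_pos (by exact_mod_cast hS)
  -- In `C`, the factor `128 = 8 * 16` comes from the number of pairs and the divergence bound
  -- `16uη²`, and `1280` from `η`. With `ε(1 - γ) ≤ 1 / 10000` and `ζ(1 - γ) ≤ 1`, `η ≤ 1 / 4`; `δ <
  -- 1 / 4` keeps the logarithm nonnegative.
  refine ⟨1 / (128 * 1280 ^ 2), 1 / 10000, 1 / 4, fun S => 1 - 1 / 10000 / Real.log S,
    fun γ ζ => 1 / 10000 * (1 / (1 - γ) * min 1 (γ / ((1 - γ) * ζ))), by norm_num, by norm_num,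
    ⟨by norm_num, by norm_num⟩, fun S hS => ⟨?_, le_rfl⟩, fun γ hγ ζ hζ => ⟨le_rfl, ?_⟩, ?_⟩
  · exact sub_lt_sub_left (div_lt_div_of_pos_right (by norm_num) (hlog S hS)) _
  · have hγ0 := hγ.1
    have hγ1 : 0 < 1 - γ := sub_pos.2 hγ.2
    have hζ0 := hζ.1
    exact mul_le_of_le_one_left (by positivity) (by norm_num)
  · intro S A hS hA γ hγ ζ hζ ε hε δ hδ
    have hγ1 : 0 < 1 - γ := sub_pos.2 hγ.2
    refine LowerBound.exists_hard_spec hS hA hγ.2 ?_ hζ.1 ((le_div_iff₀ hγ1).1 hζ.2) hε.1 ?_ hδ.1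
      hδ.2
    · rw [← le_div_iff₀ (hlog S hS)]
      have := hγ.1
      simp only at this
      linarith
    · rw [← le_div_iff₀ hγ1]
      refine hε.2.le.trans ?_
      rw [div_eq_mul_one_div (1 / 10000 : ℝ)]
      exact mul_le_mul_of_nonneg_left
        (mul_le_of_le_one_right (by positivity) (min_le_left _ _)) (by norm_num)
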